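/- Let $W:[0,1]^2\to[0,1]$ be a graphon, i.e. a symmetric measurable function. Let $X=(X_i)_{i\ge 1}$ be independent random variables, uniform on $[0,1]$, and for $n\ge 1$ let $G_n$ be the associated $W$-random graph on $[n]=\{1,\dots,n\}$: given $X$, the pairs $\{i,j\}$, $1\le i<j\le n$, are edges of $G_n$ independently of each other, with probability $W(X_i,X_j)$. Let $\mathcal F$ be the set of simple finite graphs; the vertex set $V(F)$ of a graph $F$ with $p$ vertices is identified with $[p]$, and $e(F)$ is its number of edges. For $F\in\mathcal F$ with $p$ vertices and a graph $G$ with $n\ge p$ vertices put $$t_{\rm ind}(F,G)=\frac{(n-p)!}{n!}\,\bigl|\{f:V(F)\to V(G)\text{ injective}: \{i,j\}\in E(F)\Leftrightarrow\{f(i),f(j)\}\in E(G)\}\bigr| ,$$ (the value given to it when $n<p$ is irrelevant), and $$t(F,W)=\int_{[0,1]^p}\prod_{\{i,j\}\in E(F)}W(x_i,x_j)\,dx,\qquad t_{\rm ind}(F,W)=\int_{[0,1]^p}\prod_{\{i,j\}\in E(F)}W(x_i,x_j)\prod_{i<j,\ \{i,j\}\notin E(F)}(1-W(x_i,x_j))\,dx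 .$$ For $q\in[p]$ and $u\in[0,1]$, let $t_u(F^q,W)$ be the integral $\int\prod_{\{i,j\}\in E(F)}W(x_i,x_j)\prod_{m\ne q}dx_m$ with $x_q=u$. Write $F'\ge F$ if $V(F')=V(F)$ and $E(F)\subset E(F')$. For graphs $F,F'$ and vertices $q\in V(F)$, $q'\in V(F')$, let $(F\bowtie F')(q,q')$ be the disjoint union of $F$ and $F'$ in which $q$ and $q'$ are identified. Then, as $n\to\infty$, the finite-dimensional distributions of $\bigl(\sqrt n\,(t_{\rm ind}(F,G_n)-t_{\rm ind}(F,W)):F\in\mathcal F\bigr)$ converge to those of a centered Gaussian process $\Theta_{\rm ind}=(\Theta_{\rm ind}(F):F\in\mathcal F)$ whose covariance function $K_{\rm ind}$ is given, for $F_1,F_2\in\mathcal F$ with $p_1$ and $p_2$ vertices and $U$ uniform on $[0,1]$, by $$K_{\rm ind}(F_1,F_2)=\operatorname{Cov}\Bigl(\sum_{F_1'\ge F_1}(-1)^{e(F_1')-e(F_1)}\sum_{q=1}^{p_1}t_U((F_1')^q,W),\ \sum_{F_2'\ge F_2}(-1)^{e(F_2')-e(F_2)}\sum_{q=1}^{p_2}t_U((F_2')^q,W)\Bigr)$$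 $$=\sum_{F_1'\ge F_1,\ F_2'\ge F_2}(-1)^{e(F_1')-e(F_1)+e(F_2')-e(F_2)}\Bigl(\sum_{q=1}^{p_1}\sum_{q'=1}^{p_2}t\bigl((F_1'\bowtie F_2')(q,q'),W\bigr)-p_1p_2\,t(F_1',W)\,t(F_2',W)\Bigr).$$ -/

import Mathlib

open MeasureTheory ProbabilityTheory Filter
open scoped unitInterval

noncomputable section

/-- A graphon: a symmetric measurable function `W : [0,1]² → [0,1]`. -/
structure Graphon where
  toFun : I → I → I
  symm : ∀ x y, toFun x y = toFun y x
  measurable : Measurable (Function.uncurry toFun)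

/-- The set `𝓕` of simple finite graphs; the vertex set of a graph with `p` vertices is identified
with a set of `p` labels. -/
abbrev FinGraph : Type := Σ p : ℕ, SimpleGraph (Fin p)

section FiniteGraphs

variable {V V' : Type*} [Fintype V] [DecidableEq V] [Fintype V'] [DecidableEq V']

open scoped Classical in
/-- `e(F)`, the number of edges of `F`. -/
def SimpleGraph.numEdges (F : SimpleGraph V) : ℕ := F.edgeFinset.card

open scoped Classical in
/-- The simple graphs `F' ≥ F`: same vertex set as `F`, and `E(F) ⊆ E(F')`. -/
def SimpleGraph.supergraphs (F : SimpleGraph V) : Finset (SimpleGraph V) :=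
  Finset.univ.filter fun F' => F ≤ F'

/-- The Möbius sign `(-1)^(e(F') - e(F))`; it is used only for `F' ≥ F`, where the exponent is
a true difference. -/
def SimpleGraph.moebiusSign (F F' : SimpleGraph V) : ℝ :=
  (-1 : ℝ) ^ (F'.numEdges - F.numEdges)

/-- The induced homomorphism density `t_ind(F, G) = |Ind(F, G)| / A_n^p`, where `p = v(F)`,
`n = v(G)`, `A_n^p = n (n - 1) ⋯ (n - p + 1)`, and where `Ind(F, G)` is the set of injective maps
that preserve both adjacency and non-adjacency. -/
def SimpleGraph.indDensity (F : SimpleGraph V) (G : SimpleGraph V') : ℝ :=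
  (Nat.card (F ↪g G) : ℝ) / ((Fintype.card V').descFactorial (Fintype.card V) : ℝ)

/-- The quotient map of the disjoint union `V ⊔ V'` which identifies `i' ∈ V'` with `i ∈ V`. -/
def glueMap (i : V) (i' : V') : V ⊕ V' → V ⊕ {w : V' // w ≠ i'} :=
  Sum.elim Sum.inl fun w => if h : w = i' then Sum.inl i else Sum.inr ⟨w, h⟩

/-- `(F ⋈ F')(i, i') = (F ⊔ F') / {i ∼ i'}`: the disjoint union of `F` and `F'`, in which the
vertices `i` of `F` and `i'` of `F'` are identified. -/
def SimpleGraph.glue (F : SimpleGraph V) (F' : SimpleGraph V') (i : V) (i' : V') :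
    SimpleGraph (V ⊕ {w : V' // w ≠ i'}) :=
  (F.sum F').map (glueMap i i')

namespace Graphon

/-- `W(x_i, x_j)`, as a function of the unordered pair `{i, j}`. -/
def pairValue {ι : Type*} (W : Graphon) (x : ι → I) : Sym2 ι → ℝ :=
  Sym2.lift ⟨fun i j => (W.toFun (x i) (x j) : ℝ), fun i j => by simp only [W.symm (x i) (x j)]⟩

open scoped Classical in
/-- `∏_{ {i,j} ∈ E(F) } W(x_i, x_j)`. -/
def homWeight (W : Graphon) (F : SimpleGraph V) (x : V → I) : ℝ :=
  ∏ e ∈ F.edgeFinset, W.pairValue x e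

open scoped Classical in
/-- `∏_{ {i,j} ∈ E(F) } W(x_i, x_j) ∏_{ {i,j} ∉ E(F) } (1 - W(x_i, x_j))`, where the second product
runs over the pairs of distinct vertices that are not edges. -/
def indWeight (W : Graphon) (F : SimpleGraph V) (x : V → I) : ℝ :=
  (∏ e ∈ F.edgeFinset, W.pairValue x e) * ∏ e ∈ Fᶜ.edgeFinset, (1 - W.pairValue x e)

/-- The homomorphism density `t(F, W)`. -/
def homDensity (W : Graphon) (F : SimpleGraph V) : ℝ :=
  ∫ x : V → I, W.homWeight F x

/-- The induced homomorphism density `t_ind(F, W)`. -/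
def indDensity (W : Graphon) (F : SimpleGraph V) : ℝ :=
  ∫ x : V → I, W.indWeight F x

/-- The homomorphism density `t_u(F^q, W)` of the graph `F` with one labelled vertex `q`: the
variable attached to `q` is set to `u`, and all the others are integrated over `[0,1]`. (The
coordinate `y q` does not occur in the integrand, and integrating it out contributes a factor
`1`.) -/
def rootedHomDensity (W : Graphon) (F : SimpleGraph V) (q : V) (u : I) : ℝ :=
  ∫ y : V → I, W.homWeight F (Function.update y q u)

/-- The function `u ↦ ∑_{F' ≥ F} (-1)^(e(F') - e(F)) ∑_q t_u((F')^q, W)`. -/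
def indProjection (W : Graphon) (F : SimpleGraph V) (u : I) : ℝ :=
  ∑ F' ∈ F.supergraphs, F.moebiusSign F' * ∑ q : V, W.rootedHomDensity F' q u

/-- The covariance function `K_ind`: the covariance of `indProjection` of `F₁` and of `F₂`
evaluated at the same uniform random variable on `[0,1]`. -/
def indCovariance (W : Graphon) (F₁ F₂ : FinGraph) : ℝ :=
  cov[W.indProjection F₁.2, W.indProjection F₂.2; (volume : Measure I)]

end Graphon

end FiniteGraphs

/-- `X` is a sequence of independent uniform random variables on `[0,1]`, and for every `n`, `G n`
is the `W`-random graph with `n` vertices associated to `X`: conditionally on the sequence `X`, the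
pairs `{i, j}` of distinct vertices are edges of `G n` independently of each other, with
probability `W(X_i, X_j)`; that is, the conditional probability of `{G n = H}` given `X` is
`∏_{ {i,j} ∈ E(H) } W(X_i, X_j) ∏_{ {i,j} ∉ E(H) } (1 - W(X_i, X_j))` for every graph `H`. -/
structure IsWRandomGraphSequence {Ω : Type*} [MeasurableSpace Ω] (W : Graphon) (P : Measure Ω)
    (X : ℕ → Ω → I) (G : (n : ℕ) → Ω → SimpleGraph (Fin n)) : Prop where
  measurable_position : ∀ i, Measurable (X i)
  uniform : ∀ i, P.map (X i) = volume
  indep : iIndepFun X P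
  measurable_graph : ∀ n, Measurable (G n)
  conditional_law : ∀ (n : ℕ) (H : SimpleGraph (Fin n)) (B : Set (ℕ → I)), MeasurableSet B →
    P {ω | G n ω = H ∧ (fun i => X i ω) ∈ B} =
      ∫⁻ ω in {ω | (fun i => X i ω) ∈ B}, ENNReal.ofReal (W.indWeight H fun i => X i ω) ∂P

end

noncomputable section

set_option linter.unusedSectionVars false

/-! Let F have p vertices. The density of F in G_n is the average, over the embeddings f of V(F) in
[n], of the indicator that f is an induced copy; given the positions X, this indicator has mean
`indWeight F (X ∘ f)`. Both the positions and the edges are random, but only the positions matter at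
scale √n. The Hájek projection `hajek` keeps only the mean of the weight and its conditional
expectations given one variable. Since f q is equidistributed on [n] (`sum_embedding_apply`), its
average over f is an affine function of the i.i.d. sum of the `indProjection F (X k)`, to which the
one-dimensional central limit theorem applies.

What is left, `residual`, is negligible in L². If f and g share at most one vertex, they use
disjoint sets of pairs, so given X the mean of the product of the two indicators factorizes; the two
differences weight minus projection then have a product of integral zero, because each has mean zero
given any single variable (`integral_residual_mul`). Only the O(n^(2p-2)) pairs (f, g) with two
common vertices contribute (`card_overlappingPairs_le`). After multiplication by √n /
(n(n-1)⋯(n-p+1)), the second moment is O(1/n).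

Slutsky's lemma and the Cramér-Wold device then give joint convergence. The limiting process exists
because covariances are inner products in L²: for a countable family, Gram-Schmidt coefficients
applied to independent standard normals realize them. The explicit covariance follows by
bilinearity, since gluing two graphs at one vertex multiplies their weights, which integrate
separately once the shared variable is fixed (`homDensity_glue`). -/

theorem MeasureTheory.MeasurePreserving.integral_comp_of_measurable {β γ : Type*}
    [MeasurableSpace β] [MeasurableSpace γ] {μ : Measure β} {ν : Measure γ} {T : β → γ}
    (hT : MeasurePreserving T μ ν) {φ : γ → ℝ} (hφ : Measurable φ) :
    ∫ x, φ (T x) ∂μ = ∫ y, φ y ∂ν := by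
  rw [← hT.map_eq, integral_map hT.measurable.aemeasurable hφ.aestronglyMeasurable]

/-! ### Integration over product spaces, by resampling coordinates -/

section ProductMeasure

variable {α ι V V' : Type*} [MeasureSpace α] [IsProbabilityMeasure (volume : Measure α)]
  [Fintype ι] [Fintype V] [Fintype V']

open scoped Classical in
/-- Resampling the coordinates in `T` by an independent copy preserves a product measure. -/
theorem measurePreserving_piecewise (T : Set ι) :
    MeasurePreserving (fun p : (ι → α) × (ι → α) => T.piecewise p.2 p.1)
      (volume.prod volume) volume := by
  have h1 := (volume_measurePreserving_arrowProdEquivProdArrow α α ι).symm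
  have h2 : MeasurePreserving
      (fun (p : ι → α × α) i => if i ∈ T then (p i).2 else (p i).1) volume volume := by
    refine volume_preserving_pi (f := fun i (p : α × α) => if i ∈ T then p.2 else p.1) fun i => ?_
    by_cases h : i ∈ T
    · simpa [h] using! measurePreserving_snd
    · simpa [h] using! measurePreserving_fst
  exact h2.comp h1

/-- Reindexing along an injective map preserves a product of probability measures. -/
theorem measurePreserving_comp_injective {f : V → ι} (hf : Function.Injective f) :
    MeasurePreserving (fun x : ι → α => x ∘ f) volume volume := by
  have h := (iIndepFun_pi (μ := fun _ : ι => (volume : Measure α)) (X := fun _ => id)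
    fun _ => aemeasurable_id).precomp hf
  have h' := (iIndepFun_iff_map_fun_eq_pi_map fun v => (measurable_pi_apply (f v)).aemeasurable).1 h
  refine ⟨by fun_prop, ?_⟩
  refine h'.trans ?_
  refine congrArg Measure.pi (funext fun v => ?_)
  exact (measurePreserving_eval (fun _ : ι => (volume : Measure α)) (f v)).map_eq

theorem integral_comp_injective {f : V → ι} (hf : Function.Injective f) {φ : (V → α) → ℝ}
    (hφ : Measurable φ) : ∫ x : ι → α, φ (x ∘ f) = ∫ y, φ y :=
  ((measurePreserving_comp_injective hf).integral_comp_of_measurable hφ)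

theorem integrable_of_bounded {β : Type*} [MeasurableSpace β] {μ : Measure β} [IsFiniteMeasure μ]
    {φ : β → ℝ} (hφ : Measurable φ) {C : ℝ} (hC : ∀ x, |φ x| ≤ C) : Integrable φ μ :=
  Integrable.of_bound hφ.aestronglyMeasurable C (ae_of_all _ hC)

open scoped Classical in
/-- The integral of a function of finitely many variables over all the variables but one. -/
def rootedIntegral (φ : (V → α) → ℝ) (q : V) (u : α) : ℝ :=
  ∫ y : V → α, φ (Function.update y q u)

open scoped Classical in
theorem integrable_comp_update {φ : (V → α) → ℝ} (hφ : Measurable φ) {C : ℝ}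
    (hC : ∀ x, |φ x| ≤ C) (q : V) (u : α) :
    Integrable (fun y : V → α => φ (Function.update y q u)) volume :=
  integrable_of_bounded (hφ.comp measurable_update_left) fun _ => hC _

theorem measurable_rootedIntegral {φ : (V → α) → ℝ} (hφ : Measurable φ) (q : V) :
    Measurable (rootedIntegral φ q) := by
  classical
  unfold rootedIntegral
  have : Measurable (fun p : α × (V → α) => φ (Function.update p.2 q p.1)) := by
    refine hφ.comp (measurable_pi_iff.2 fun v => ?_)
    by_cases h : v = q
    · subst h; simpa using measurable_fst
    · simp only [Function.update_of_ne h]; fun_prop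
  have h := this.stronglyMeasurable.integral_prod_right' (ν := (volume : Measure (V → α)))
  convert! h.measurable

theorem abs_integral_le_of_bounded {β : Type*} [MeasurableSpace β] {μ : Measure β}
    [IsProbabilityMeasure μ] {φ : β → ℝ} {C : ℝ} (hC : ∀ x, |φ x| ≤ C) : |∫ x, φ x ∂μ| ≤ C := by
  simpa using norm_integral_le_of_norm_le_const (μ := μ) (f := φ) (ae_of_all _ hC)

theorem abs_rootedIntegral_le {φ : (V → α) → ℝ} {C : ℝ} (hC : ∀ x, |φ x| ≤ C) (q : V) (u : α) :
    |rootedIntegral φ q u| ≤ C :=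
  abs_integral_le_of_bounded fun _ => hC _

theorem rootedIntegral_sub {φ ψ : (V → α) → ℝ} (hφ : Measurable φ) (hψ : Measurable ψ) {C C' : ℝ}
    (hC : ∀ x, |φ x| ≤ C) (hC' : ∀ x, |ψ x| ≤ C') (q : V) (u : α) :
    rootedIntegral (fun z => φ z - ψ z) q u = rootedIntegral φ q u - rootedIntegral ψ q u :=
  integral_sub (integrable_comp_update hφ hC q u) (integrable_comp_update hψ hC' q u)

theorem rootedIntegral_const_add_sum {κ : Type*} [Fintype κ] (c : ℝ) {φ : κ → (V → α) → ℝ}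
    (hφ : ∀ k, Measurable (φ k)) {C : ℝ} (hC : ∀ k x, |φ k x| ≤ C) (q : V) (u : α) :
    rootedIntegral (fun z => c + ∑ k, φ k z) q u = c + ∑ k, rootedIntegral (φ k) q u := by
  have hi := fun k => integrable_comp_update (hφ k) (hC k) q u
  rw [rootedIntegral, integral_add (integrable_const _) (integrable_finsetSum _ fun k _ => hi k),
    integral_finsetSum _ fun k _ => hi k]
  simp [rootedIntegral]

theorem rootedIntegral_eval_self (ρ : α → ℝ) (q : V) (u : α) :
    rootedIntegral (fun z => ρ (z q)) q u = ρ u := by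
  simp [rootedIntegral]

theorem rootedIntegral_eval_of_ne {ρ : α → ℝ} (hρ : Measurable ρ) {q q' : V} (h : q' ≠ q) (u : α) :
    rootedIntegral (fun z => ρ (z q')) q u = ∫ v, ρ v := by
  classical
  simp only [rootedIntegral, Function.update_of_ne h]
  exact (measurePreserving_eval (fun _ : V => (volume : Measure α)) q').integral_comp_of_measurable hρ

open scoped Classical in
-- This replaces Fubini for a splitting of the index set: the coordinates in T are integrated first,
-- with no need to split the product space into two factors.
theorem integral_piecewise (T : Set ι) {φ : (ι → α) → ℝ} (hφ : Measurable φ) {C : ℝ}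
    (hC : ∀ x, |φ x| ≤ C) :
    ∫ x : ι → α, φ x = ∫ x : ι → α, ∫ y : ι → α, φ (T.piecewise y x) := by
  have h := measurePreserving_piecewise (α := α) T
  rw [← h.integral_comp_of_measurable hφ, integral_prod]
  exact integrable_of_bounded (hφ.comp h.measurable) fun _ => hC _

/-- Integrate first over all the variables but the one indexed by `q`. -/
theorem integral_mul_eval (q : V) {φ : (V → α) → ℝ} (hφ : Measurable φ) {C : ℝ}
    (hC : ∀ x, |φ x| ≤ C) {ρ : α → ℝ} (hρ : Measurable ρ) {C' : ℝ} (hC' : ∀ x, |ρ x| ≤ C') :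
    ∫ x : V → α, φ x * ρ (x q) = ∫ u, rootedIntegral φ q u * ρ u := by
  classical
  have hC0 : 0 ≤ C := by
    obtain ⟨x⟩ := nonempty_of_isProbabilityMeasure (volume : Measure (V → α))
    exact (abs_nonneg _).trans (hC x)
  -- Every coordinate except q is resampled.
  obtain ⟨T, hT⟩ : ∃ T : Set V, T = {q}ᶜ := ⟨_, rfl⟩
  rw [integral_piecewise T (by fun_prop) (C := C * C')]
  · have key : ∀ x y : V → α, T.piecewise y x = Function.update y q (x q) := by
      intro x y
      ext v
      by_cases h : v = q
      · subst h; simp [hT]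
      · simp [h, hT, Set.piecewise]
    simp_rw [key, Function.update_self, integral_mul_const]
    exact (measurePreserving_eval (fun _ : V => (volume : Measure α)) q).integral_comp_of_measurable
      (φ := fun u => rootedIntegral φ q u * ρ u) ((measurable_rootedIntegral hφ q).mul hρ)
  · intro x
    rw [abs_mul]
    exact mul_le_mul (hC _) (hC' _) (abs_nonneg _) hC0

theorem integral_rootedIntegral (q : V) {φ : (V → α) → ℝ} (hφ : Measurable φ) {C : ℝ}
    (hC : ∀ x, |φ x| ≤ C) : ∫ u, rootedIntegral φ q u = ∫ x, φ x := by
  simpa using (integral_mul_eval q hφ hC (ρ := fun _ => 1) (by fun_prop) (C' := 1)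
    (by simp)).symm

/-- Functions of two sets of variables sharing exactly one variable. -/
theorem integral_mul_comp_of_share_one {f : V → ι} {g : V' → ι} (hf : Function.Injective f)
    (hg : Function.Injective g) {q : V} {q' : V'} (hq : f q = g q')
    (hfg : ∀ a b, f a = g b → b = q') {φ : (V → α) → ℝ} {ψ : (V' → α) → ℝ} (hφ : Measurable φ)
    (hψ : Measurable ψ) {C C' : ℝ} (hC : ∀ x, |φ x| ≤ C) (hC' : ∀ x, |ψ x| ≤ C') :
    ∫ x : ι → α, φ (x ∘ f) * ψ (x ∘ g) =
      ∫ u, rootedIntegral φ q u * rootedIntegral ψ q' u := by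
  classical
  have hC0 : 0 ≤ C := by
    obtain ⟨x⟩ := nonempty_of_isProbabilityMeasure (volume : Measure (V → α))
    exact (abs_nonneg _).trans (hC x)
  -- The variables of ψ other than the shared one are resampled; by `hfg`, φ sees none of them.
  obtain ⟨T, hT⟩ : ∃ T : Set ι, T = g '' {q'}ᶜ := ⟨_, rfl⟩
  rw [integral_piecewise T (C := C * C')]
  · have h1 : ∀ x y : ι → α, T.piecewise y x ∘ f = x ∘ f := by
      intro x y
      ext a
      have : f a ∉ T := by
        rw [hT]
        rintro ⟨b, hb, h⟩
        exact hb (hfg a b h.symm)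
      simp [this]
    have h2 : ∀ x y : ι → α, T.piecewise y x ∘ g =
        Function.update (y ∘ g) q' (x (f q)) := by
      intro x y
      ext b
      by_cases h : b = q'
      · subst h; simp [hT, hg.mem_set_image, hq]
      · simp [hT, Set.piecewise, hg.mem_set_image, h]
    simp_rw [h1, h2, integral_const_mul]
    have h3 : ∀ u : α, ∫ y : ι → α, ψ (Function.update (y ∘ g) q' u) = rootedIntegral ψ q' u := by
      intro u
      exact integral_comp_injective hg (φ := fun z => ψ (Function.update z q' u))
        (hψ.comp measurable_update_left)
    simp_rw [h3]
    have hr := measurable_rootedIntegral hψ q'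
    rw [← integral_mul_eval q hφ hC hr (abs_rootedIntegral_le hC' q')]
    exact integral_comp_injective hf (φ := fun z => φ z * rootedIntegral ψ q' (z q))
      (by fun_prop)
  · fun_prop
  · intro x
    rw [abs_mul]
    exact mul_le_mul (hC _) (hC' _) (abs_nonneg _) hC0

/-- Functions of two disjoint sets of variables. -/
theorem integral_mul_comp_of_disjoint {f : V → ι} {g : V' → ι} (hf : Function.Injective f)
    (hg : Function.Injective g) (hfg : ∀ a b, f a ≠ g b) {φ : (V → α) → ℝ}
    {ψ : (V' → α) → ℝ} (hφ : Measurable φ)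
    (hψ : Measurable ψ) {C C' : ℝ} (hC : ∀ x, |φ x| ≤ C) (hC' : ∀ x, |ψ x| ≤ C') :
    ∫ x : ι → α, φ (x ∘ f) * ψ (x ∘ g) = (∫ x, φ x) * ∫ x, ψ x := by
  classical
  have hC0 : 0 ≤ C := by
    obtain ⟨x⟩ := nonempty_of_isProbabilityMeasure (volume : Measure (V → α))
    exact (abs_nonneg _).trans (hC x)
  obtain ⟨T, hT⟩ : ∃ T : Set ι, T = Set.range g := ⟨_, rfl⟩
  rw [integral_piecewise T (C := C * C')]
  · have h1 : ∀ x y : ι → α, T.piecewise y x ∘ f = x ∘ f := by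
      intro x y
      ext a
      have : f a ∉ T := by
        rw [hT]
        rintro ⟨b, h⟩
        exact hfg a b h.symm
      simp only [Function.comp_apply, Set.piecewise_eq_of_notMem _ _ _ this]
    have h2 : ∀ x y : ι → α, T.piecewise y x ∘ g = y ∘ g := by
      intro x y
      ext b
      simp [hT]
    simp_rw [h1, h2, integral_const_mul, integral_mul_const]
    rw [integral_comp_injective hf hφ, integral_comp_injective hg hψ]
  · fun_prop
  · intro x
    rw [abs_mul]
    exact mul_le_mul (hC _) (hC' _) (abs_nonneg _) hC0

end ProductMeasure

/-! ### Weights of graphs, inclusion-exclusion and gluing -/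

section GraphWeights

variable {V V' ι : Type*} [Fintype V] [DecidableEq V] [Fintype V'] [DecidableEq V'] [Fintype ι]
  [DecidableEq ι]

/-- The pairs of distinct elements of `V`. -/
def distinctPairs (V : Type*) [Fintype V] [DecidableEq V] : Finset (Sym2 V) :=
  Finset.univ.filter fun e => ¬ e.IsDiag

theorem mem_distinctPairs {e : Sym2 V} : e ∈ distinctPairs V ↔ ¬ e.IsDiag := by
  simp [distinctPairs]

open scoped Classical in
theorem SimpleGraph.filter_distinctPairs (F : SimpleGraph V) :
    (distinctPairs V).filter (· ∈ F.edgeSet) = F.edgeFinset := by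
  ext e
  simp only [Finset.mem_filter, mem_distinctPairs, SimpleGraph.mem_edgeFinset]
  exact ⟨fun h => h.2, fun h => ⟨F.not_isDiag_of_mem_edgeSet h, h⟩⟩

open scoped Classical in
theorem SimpleGraph.filter_not_distinctPairs (F : SimpleGraph V) :
    (distinctPairs V).filter (· ∉ F.edgeSet) = Fᶜ.edgeFinset := by
  ext e
  induction e with
  | _ a b => simp [mem_distinctPairs, SimpleGraph.compl_adj]

open scoped Classical in
/-- Expanding a product over pairs as a sum over graphs. -/
theorem sum_simpleGraph_prod (a b : Sym2 V → ℝ) :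
    ∑ H : SimpleGraph V, ∏ e ∈ distinctPairs V, (if e ∈ H.edgeSet then a e else b e) =
      ∏ e ∈ distinctPairs V, (a e + b e) := by
  rw [Finset.prod_add]
  refine Finset.sum_bij' (fun H _ => H.edgeFinset)
    (fun s _ => SimpleGraph.fromEdgeSet (s : Set (Sym2 V))) ?_ (by simp) ?_ ?_ ?_
  · intro H _
    rw [← H.filter_distinctPairs]
    exact Finset.mem_powerset.2 (Finset.filter_subset _ _)
  · intro H _
    simp
  · intro s hs
    rw [Finset.mem_powerset] at hs
    ext e
    simp only [SimpleGraph.mem_edgeFinset, SimpleGraph.edgeSet_fromEdgeSet, Set.mem_sdiff,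
      Finset.mem_coe]
    exact ⟨fun h => h.1, fun h => ⟨h, mem_distinctPairs.1 (hs h)⟩⟩
  · intro H _
    rw [Finset.prod_ite, H.filter_distinctPairs]
    congr 2
    rw [← H.filter_distinctPairs]
    ext e
    simp +contextual

namespace Graphon

theorem pairValue_mk (W : Graphon) (x : ι → I) (i j : ι) :
    W.pairValue x s(i, j) = W.toFun (x i) (x j) := rfl

theorem pairValue_map (W : Graphon) (x : ι → I) (f : V → ι) (e : Sym2 V) :
    W.pairValue x (e.map f) = W.pairValue (x ∘ f) e := by
  induction e with
  | _ a b => rfl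

theorem measurable_pairValue (W : Graphon) (e : Sym2 ι) :
    Measurable fun x : ι → I => W.pairValue x e := by
  induction e with
  | _ a b =>
    simp only [pairValue_mk]
    have h : Measurable fun x : ι → I => (x a, x b) := by fun_prop
    exact (W.measurable.comp h).subtype_val

theorem pairValue_nonneg (W : Graphon) (x : ι → I) (e : Sym2 ι) : 0 ≤ W.pairValue x e := by
  induction e with
  | _ a b => exact (W.toFun _ _).2.1

theorem pairValue_le_one (W : Graphon) (x : ι → I) (e : Sym2 ι) : W.pairValue x e ≤ 1 := by
  induction e with
  | _ a b => exact (W.toFun _ _).2.2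

open scoped Classical in
theorem indWeight_eq_prod (W : Graphon) (F : SimpleGraph V) (x : V → I) :
    W.indWeight F x = ∏ e ∈ distinctPairs V,
      if e ∈ F.edgeSet then W.pairValue x e else 1 - W.pairValue x e := by
  rw [Finset.prod_ite, F.filter_distinctPairs, F.filter_not_distinctPairs]
  rfl

theorem measurable_homWeight (W : Graphon) (F : SimpleGraph V) :
    Measurable (W.homWeight F) := by
  unfold homWeight
  exact Finset.measurable_prod _ fun e _ => W.measurable_pairValue e

theorem measurable_indWeight (W : Graphon) (F : SimpleGraph V) :
    Measurable (W.indWeight F) := by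
  unfold indWeight
  exact (Finset.measurable_prod _ fun e _ => W.measurable_pairValue e).mul
    (Finset.measurable_prod _ fun e _ => measurable_const.sub (W.measurable_pairValue e))

theorem abs_homWeight_le (W : Graphon) (F : SimpleGraph V) (x : V → I) :
    |W.homWeight F x| ≤ 1 := by
  unfold homWeight
  rw [abs_of_nonneg (Finset.prod_nonneg fun e _ => W.pairValue_nonneg x e)]
  exact Finset.prod_le_one (fun e _ => W.pairValue_nonneg x e) fun e _ => W.pairValue_le_one x e

theorem indWeight_nonneg (W : Graphon) (F : SimpleGraph V) (x : V → I) :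
    0 ≤ W.indWeight F x :=
  mul_nonneg (Finset.prod_nonneg fun e _ => W.pairValue_nonneg x e)
    (Finset.prod_nonneg fun e _ => sub_nonneg.2 (W.pairValue_le_one x e))

theorem abs_indWeight_le (W : Graphon) (F : SimpleGraph V) (x : V → I) :
    |W.indWeight F x| ≤ 1 := by
  rw [abs_of_nonneg (W.indWeight_nonneg F x)]
  refine mul_le_one₀ (Finset.prod_le_one (fun e _ => W.pairValue_nonneg x e)
    fun e _ => W.pairValue_le_one x e)
    (Finset.prod_nonneg fun e _ => sub_nonneg.2 (W.pairValue_le_one x e))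
    (Finset.prod_le_one (fun e _ => sub_nonneg.2 (W.pairValue_le_one x e)) fun e _ => ?_)
  linarith [W.pairValue_nonneg x e]

open scoped Classical in
/-- Inclusion-exclusion: induced weights in terms of homomorphism weights. -/
theorem indWeight_eq_sum_supergraphs (W : Graphon) (F : SimpleGraph V) (x : V → I) :
    W.indWeight F x = ∑ F' ∈ F.supergraphs, F.moebiusSign F' * W.homWeight F' x := by
  -- At a pair outside F the factor 1 - W is split into -W (pair present in F') and 1 (absent). At
  -- an edge of F the absent term is 0, which kills every F' that does not contain F.
  have h := sum_simpleGraph_prod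
    (fun e : Sym2 V => if e ∈ F.edgeSet then W.pairValue x e else -W.pairValue x e)
    (fun e : Sym2 V => if e ∈ F.edgeSet then 0 else 1)
  have h1 : ∏ e ∈ distinctPairs V,
      ((if e ∈ F.edgeSet then W.pairValue x e else -W.pairValue x e) +
        (if e ∈ F.edgeSet then 0 else 1)) = W.indWeight F x := by
    rw [indWeight_eq_prod]
    refine Finset.prod_congr rfl fun e _ => ?_
    split_ifs <;> ring
  rw [← h1, ← h, SimpleGraph.supergraphs, Finset.sum_filter]
  refine Finset.sum_congr rfl fun F' _ => ?_
  split_ifs with hF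
  · have hs := SimpleGraph.edgeSet_subset_edgeSet.2 hF
    have h2 : ∏ e ∈ distinctPairs V, (if e ∈ F'.edgeSet then
        (if e ∈ F.edgeSet then W.pairValue x e else -W.pairValue x e)
        else (if e ∈ F.edgeSet then 0 else 1)) = ∏ e ∈ F'.edgeFinset,
          ((if e ∈ F.edgeSet then 1 else -1) * W.pairValue x e) := by
      rw [← F'.filter_distinctPairs, Finset.prod_filter]
      refine Finset.prod_congr rfl fun e _ => ?_
      by_cases h1 : e ∈ F'.edgeSet
      · simp [h1]
      · have h2 : e ∉ F.edgeSet := fun h => h1 (hs h)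
        simp only [h1, h2, if_false]
    rw [h2, Finset.prod_mul_distrib]
    congr 1
    rw [Finset.prod_ite, Finset.prod_const_one, one_mul, Finset.prod_const,
      SimpleGraph.moebiusSign, SimpleGraph.numEdges, SimpleGraph.numEdges,
      ← Finset.card_sdiff_of_subset (SimpleGraph.edgeFinset_mono hF)]
    congr 2
    ext e
    simp
  · have : ∃ e ∈ F.edgeSet, e ∉ F'.edgeSet := by
      by_contra! hc
      exact hF (SimpleGraph.edgeSet_subset_edgeSet.1 hc)
    obtain ⟨e, he, he'⟩ := this
    exact Finset.prod_eq_zero (mem_distinctPairs.2 (F.not_isDiag_of_mem_edgeSet he))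
      (by simp [he, he'])

theorem rootedHomDensity_eq (W : Graphon) (F : SimpleGraph V) (q : V) :
    W.rootedHomDensity F q = rootedIntegral (W.homWeight F) q := by
  funext u
  unfold rootedHomDensity rootedIntegral
  congr!

/-- Inclusion-exclusion under the integral sign: the alternating sum defining the covariance is a
sum of conditional expectations of one induced weight, the form needed for the Hájek projection. -/
theorem indProjection_eq (W : Graphon) (F : SimpleGraph V) (u : I) :
    W.indProjection F u = ∑ q, rootedIntegral (W.indWeight F) q u := by
  classical
  simp only [indProjection, rootedHomDensity_eq, Finset.mul_sum]
  rw [Finset.sum_comm]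
  refine Finset.sum_congr rfl fun q _ => ?_
  simp only [rootedIntegral, indWeight_eq_sum_supergraphs]
  rw [integral_finsetSum _ fun F' _ => ?_]
  · simp only [integral_const_mul]
  · exact (integrable_comp_update (W.measurable_homWeight F') (W.abs_homWeight_le F') q u).const_mul _

/-- The second vertex set embeds in the glued vertex set. -/
theorem glueMap_inr_injective (i : V) (i' : V') :
    Function.Injective fun w : V' => glueMap i i' (Sum.inr w) := by
  intro a b h
  simp only [glueMap, Sum.elim_inr] at h
  split_ifs at h with h1 h2
  · rw [h1, h2]
  · simpa using h

open scoped Classical in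
-- The two vertex sets meet in a single point after gluing, so no edge of F is merged with an edge
-- of F' and the product over edges splits.
theorem homWeight_glue (W : Graphon) (F : SimpleGraph V) (F' : SimpleGraph V') (i : V) (i' : V')
    (x : V ⊕ {w : V' // w ≠ i'} → I) :
    W.homWeight (F.glue F' i i') x = W.homWeight F (x ∘ Sum.inl) *
      W.homWeight F' (x ∘ fun w => glueMap i i' (Sum.inr w)) := by
  have hinj := glueMap_inr_injective i i'
  have h : (F.glue F' i i').edgeFinset = F.edgeFinset.image (Sym2.map Sum.inl) ∪
      F'.edgeFinset.image (Sym2.map fun w => glueMap i i' (Sum.inr w)) := by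
    ext e
    simp only [SimpleGraph.mem_edgeFinset, Finset.mem_union, Finset.mem_image]
    induction e with
    | _ a b =>
      rw [SimpleGraph.mem_edgeSet, SimpleGraph.glue, SimpleGraph.map_adj']
      constructor
      · rintro ⟨-, u | u, v | v, huv, rfl, rfl⟩
        · exact .inl ⟨s(u, v), by simpa using huv, rfl⟩
        · simp at huv
        · simp at huv
        · exact .inr ⟨s(u, v), by simpa using huv, rfl⟩
      · rintro (⟨e, he, h⟩ | ⟨e, he, h⟩)
        · induction e with
          | _ u v =>
            rw [SimpleGraph.mem_edgeSet] at he
            have key : s(a, b) = s(glueMap i i' (Sum.inl u), glueMap i i' (Sum.inl v)) := h.symm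
            have adj : ((F.sum F').map (glueMap i i')).Adj (glueMap i i' (Sum.inl u))
                (glueMap i i' (Sum.inl v)) :=
              SimpleGraph.map_adj_apply' (by simpa using he) (by simpa [glueMap] using he.ne)
            rw [← SimpleGraph.mem_edgeSet, ← key] at adj
            exact adj
        · induction e with
          | _ u v =>
            rw [SimpleGraph.mem_edgeSet] at he
            have key : s(a, b) = s(glueMap i i' (Sum.inr u), glueMap i i' (Sum.inr v)) := h.symm
            have adj : ((F.sum F').map (glueMap i i')).Adj (glueMap i i' (Sum.inr u))
                (glueMap i i' (Sum.inr v)) :=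
              SimpleGraph.map_adj_apply' (by simpa using he) (hinj.ne he.ne)
            rw [← SimpleGraph.mem_edgeSet, ← key] at adj
            exact adj
  -- An edge in both images would have two distinct endpoints common to both vertex sets.
  have hdisj : Disjoint (F.edgeFinset.image (Sym2.map Sum.inl))
      (F'.edgeFinset.image (Sym2.map fun w => glueMap i i' (Sum.inr w))) := by
    rw [Finset.disjoint_left]
    intro e he he'
    simp only [SimpleGraph.mem_edgeFinset, Finset.mem_image] at he he'
    obtain ⟨e₁, h₁, rfl⟩ := he
    obtain ⟨e₂, h₂, h⟩ := he'
    induction e₁ with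
    | _ a b =>
      induction e₂ with
      | _ c d =>
        have hcd : c ≠ d := SimpleGraph.Adj.ne h₂
        simp only [Sym2.map_mk, glueMap, Sum.elim_inr, Sym2.eq_iff] at h
        split_ifs at h with h1 h2 <;> simp_all
  unfold homWeight
  rw [h, Finset.prod_union hdisj, Finset.prod_image fun a _ b _ h =>
      Sym2.map.injective Sum.inl_injective h,
    Finset.prod_image fun a _ b _ h => Sym2.map.injective hinj h]
  simp only [pairValue_map]

theorem homDensity_glue (W : Graphon) (F : SimpleGraph V) (F' : SimpleGraph V') (i : V) (i' : V') :
    W.homDensity (F.glue F' i i') =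
      ∫ u, W.rootedHomDensity F i u * W.rootedHomDensity F' i' u := by
  classical
  rw [homDensity, rootedHomDensity_eq, rootedHomDensity_eq]
  simp only [homWeight_glue]
  refine integral_mul_comp_of_share_one Sum.inl_injective (glueMap_inr_injective i i')
    (by simp [glueMap]) ?_ (W.measurable_homWeight F) (W.measurable_homWeight F')
    (W.abs_homWeight_le F) (W.abs_homWeight_le F')
  intro a b h
  simp only [glueMap, Sum.elim_inr] at h
  by_contra hb
  simp [hb] at h

theorem memLp_rootedHomDensity (W : Graphon) (F : SimpleGraph V) (q : V) :
    MemLp (W.rootedHomDensity F q) 2 volume := by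
  rw [rootedHomDensity_eq]
  exact MemLp.of_bound (measurable_rootedIntegral (W.measurable_homWeight F) q).aestronglyMeasurable
    1 (ae_of_all _ (abs_rootedIntegral_le (W.abs_homWeight_le F) q))

theorem covariance_rootedHomDensity (W : Graphon) (F : SimpleGraph V) (F' : SimpleGraph V')
    (q : V) (q' : V') :
    cov[W.rootedHomDensity F q, W.rootedHomDensity F' q'; volume] =
      W.homDensity (F.glue F' q q') - W.homDensity F * W.homDensity F' := by
  rw [covariance_eq_sub (W.memLp_rootedHomDensity F q) (W.memLp_rootedHomDensity F' q'),
    homDensity_glue, rootedHomDensity_eq, rootedHomDensity_eq,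
    integral_rootedIntegral q (W.measurable_homWeight F) (W.abs_homWeight_le F),
    integral_rootedIntegral q' (W.measurable_homWeight F') (W.abs_homWeight_le F')]
  rfl

theorem covariance_indProjection (W : Graphon) (F₁ : SimpleGraph V) (F₂ : SimpleGraph V') :
    cov[W.indProjection F₁, W.indProjection F₂; (volume : Measure I)] =
      ∑ F₁' ∈ F₁.supergraphs, ∑ F₂' ∈ F₂.supergraphs,
        F₁.moebiusSign F₁' * F₂.moebiusSign F₂' *
          ((∑ q : V, ∑ q' : V', W.homDensity (F₁'.glue F₂' q q'))
            - Fintype.card V * Fintype.card V' * W.homDensity F₁' * W.homDensity F₂') := by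
  unfold indProjection
  rw [covariance_fun_sum_fun_sum' 
    (fun F' _ => (memLp_finsetSum _ fun q _ => W.memLp_rootedHomDensity F' q).const_mul _)
    (fun F' _ => (memLp_finsetSum _ fun q _ => W.memLp_rootedHomDensity F' q).const_mul _)]
  refine Finset.sum_congr rfl fun F₁' _ => Finset.sum_congr rfl fun F₂' _ => ?_
  rw [covariance_const_mul_left, covariance_const_mul_right,
    covariance_fun_sum_fun_sum (fun q => W.memLp_rootedHomDensity F₁' q)
      (fun q => W.memLp_rootedHomDensity F₂' q)]
  simp only [covariance_rootedHomDensity, Finset.sum_sub_distrib, Finset.sum_const,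
    Finset.card_univ, nsmul_eq_mul]
  ring

end Graphon
end GraphWeights

/-! ### Conditional means of embedding indicators given the positions -/

section EmbeddingIndicator

variable {V V' ι : Type*} [Fintype V] [DecidableEq V] [Fintype V'] [DecidableEq V'] [Fintype ι]
  [DecidableEq ι]

open scoped Classical in
/-- The indicator that `f` preserves adjacency and non-adjacency. -/
def SimpleGraph.embIndicator (F : SimpleGraph V) (f : V → ι) (H : SimpleGraph ι) : ℝ :=
  if ∀ a b, F.Adj a b ↔ H.Adj (f a) (f b) then 1 else 0

theorem SimpleGraph.abs_embIndicator_le (F : SimpleGraph V) (f : V → ι) (H : SimpleGraph ι) :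
    |F.embIndicator f H| ≤ 1 := by
  unfold embIndicator
  split_ifs <;> simp

open scoped Classical in
/-- Under independent edges, the expectation of a product of edge functions factorizes. -/
theorem Graphon.sum_indWeight_mul_prod (W : Graphon) (x : ι → I) (a b : Sym2 ι → ℝ) :
    ∑ H : SimpleGraph ι, W.indWeight H x *
      ∏ e ∈ distinctPairs ι, (if e ∈ H.edgeSet then a e else b e) =
      ∏ e ∈ distinctPairs ι, (W.pairValue x e * a e + (1 - W.pairValue x e) * b e) := by
  rw [← sum_simpleGraph_prod]
  refine Finset.sum_congr rfl fun H _ => ?_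
  rw [W.indWeight_eq_prod, ← Finset.prod_mul_distrib]
  refine Finset.prod_congr rfl fun e _ => ?_
  split_ifs <;> rfl

theorem Graphon.sum_indWeight (W : Graphon) (x : ι → I) :
    ∑ H : SimpleGraph ι, W.indWeight H x = 1 := by
  simpa using W.sum_indWeight_mul_prod x (fun _ => 1) (fun _ => 1)

open scoped Classical in
/-- The factor of the embedding indicator at an edge which is present (`s`) or absent (`¬ s`). -/
def SimpleGraph.edgeFactor (F : SimpleGraph V) (f : V → ι) (s : Prop) (e : Sym2 ι) : ℝ :=
  if e ∈ (distinctPairs V).image (Sym2.map f) then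
    if s ↔ e ∈ Sym2.map f '' F.edgeSet then 1 else 0 else 1

open scoped Classical in
theorem prod_image_pairs {f : V → ι} (hf : Function.Injective f) (c : Sym2 ι → ℝ) :
    ∏ e ∈ distinctPairs ι, (if e ∈ (distinctPairs V).image (Sym2.map f) then c e else 1) =
      ∏ e ∈ distinctPairs V, c (e.map f) := by
  rw [← Finset.prod_filter]
  have : (distinctPairs ι).filter (· ∈ (distinctPairs V).image (Sym2.map f)) =
      (distinctPairs V).image (Sym2.map f) := by
    ext e
    simp only [Finset.mem_filter, and_iff_right_iff_imp, Finset.mem_image, mem_distinctPairs]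
    rintro ⟨e, he, rfl⟩
    rwa [Sym2.isDiag_map hf]
  rw [this, Finset.prod_image fun a _ b _ h => Sym2.map.injective hf h]

open scoped Classical in
theorem SimpleGraph.embIndicator_eq_prod (F : SimpleGraph V) {f : V → ι}
    (hf : Function.Injective f) (H : SimpleGraph ι) :
    F.embIndicator f H = ∏ e ∈ distinctPairs ι,
      if e ∈ H.edgeSet then F.edgeFactor f True e else F.edgeFactor f False e := by
  have h : ∀ e, (if e ∈ H.edgeSet then F.edgeFactor f True e else F.edgeFactor f False e) =
      if e ∈ (distinctPairs V).image (Sym2.map f) then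
        if e ∈ H.edgeSet ↔ e ∈ Sym2.map f '' F.edgeSet then 1 else 0 else 1 := by
    intro e
    unfold edgeFactor
    by_cases h : e ∈ H.edgeSet <;> simp [h]
  simp_rw [h]
  rw [prod_image_pairs hf, Finset.prod_boole, embIndicator]
  congr 1
  rw [eq_iff_iff]
  have hinj := Sym2.map.injective hf
  constructor
  · intro h e _
    rw [hinj.mem_set_image]
    induction e with
    | _ a b => exact (h a b).symm
  · intro h a b
    by_cases hab : a = b
    · subst hab; simp
    · have := h s(a, b) (mem_distinctPairs.2 (by simpa using hab))
      rw [hinj.mem_set_image] at this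
      exact this.symm

open scoped Classical in
-- A pair outside the image of f contributes W + (1 - W) = 1, so only the pairs coming from V
-- remain.
theorem Graphon.prod_edgeFactor (W : Graphon) (F : SimpleGraph V) {f : V → ι}
    (hf : Function.Injective f) (x : ι → I) :
    ∏ e ∈ distinctPairs ι, (W.pairValue x e * F.edgeFactor f True e +
      (1 - W.pairValue x e) * F.edgeFactor f False e) = W.indWeight F (x ∘ f) := by
  have h : ∀ e, (W.pairValue x e * F.edgeFactor f True e +
      (1 - W.pairValue x e) * F.edgeFactor f False e) =
      if e ∈ (distinctPairs V).image (Sym2.map f) then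
        if e ∈ Sym2.map f '' F.edgeSet then W.pairValue x e else 1 - W.pairValue x e else 1 := by
    intro e
    unfold SimpleGraph.edgeFactor
    by_cases h : e ∈ Sym2.map f '' F.edgeSet <;> by_cases h' : e ∈ (distinctPairs V).image (Sym2.map f) <;>
      simp only [h, h', if_true, if_false, iff_true, iff_false, not_true_eq_false] <;> ring
  simp_rw [h]
  rw [prod_image_pairs hf, W.indWeight_eq_prod]
  simp only [(Sym2.map.injective hf).mem_set_image, W.pairValue_map]

/-- This is the conditional expectation of the indicator given the positions x. -/
theorem Graphon.sum_indWeight_mul_embIndicator (W : Graphon) (F : SimpleGraph V) {f : V → ι}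
    (hf : Function.Injective f) (x : ι → I) :
    ∑ H : SimpleGraph ι, W.indWeight H x * F.embIndicator f H = W.indWeight F (x ∘ f) := by
  simp_rw [F.embIndicator_eq_prod hf]
  rw [W.sum_indWeight_mul_prod, W.prod_edgeFactor F hf]

/-- Embeddings sharing at most one vertex involve disjoint sets of edges. -/
theorem Graphon.sum_indWeight_mul_embIndicator_mul (W : Graphon) (F : SimpleGraph V)
    (F' : SimpleGraph V') {f : V → ι} {g : V' → ι} (hf : Function.Injective f)
    (hg : Function.Injective g) (hfg : ∀ a a' b b', f a = g b → f a' = g b' → a = a') (x : ι → I) :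
    ∑ H : SimpleGraph ι, W.indWeight H x * (F.embIndicator f H * F'.embIndicator g H) =
      W.indWeight F (x ∘ f) * W.indWeight F' (x ∘ g) := by
  classical
  simp_rw [F.embIndicator_eq_prod hf, F'.embIndicator_eq_prod hg, ← Finset.prod_mul_distrib]
  rw [← W.prod_edgeFactor F hf, ← W.prod_edgeFactor F' hg, ← Finset.prod_mul_distrib]
  have h : ∀ (H : SimpleGraph ι) (e : Sym2 ι),
      ((if e ∈ H.edgeSet then F.edgeFactor f True e else F.edgeFactor f False e) *
        if e ∈ H.edgeSet then F'.edgeFactor g True e else F'.edgeFactor g False e) =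
      if e ∈ H.edgeSet then F.edgeFactor f True e * F'.edgeFactor g True e else
        F.edgeFactor f False e * F'.edgeFactor g False e := by
    intro H e
    split_ifs <;> rfl
  simp_rw [h]
  rw [W.sum_indWeight_mul_prod]
  refine Finset.prod_congr rfl fun e _ => ?_
  -- A pair in both images would have two shared endpoints, against `hfg`. Hence one of the two edge
  -- factors is identically 1 at e, and the mean of the product is the product of the means.
  have : e ∉ (distinctPairs V).image (Sym2.map f) ∨ e ∉ (distinctPairs V').image (Sym2.map g) := by
    by_contra! hc
    obtain ⟨h1, h2⟩ := hc
    rw [Finset.mem_image] at h1 h2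
    obtain ⟨e₁, he₁, rfl⟩ := h1
    obtain ⟨e₂, he₂, h⟩ := h2
    rw [mem_distinctPairs] at he₁ he₂
    induction e₁ with
    | _ a a' =>
      induction e₂ with
      | _ b b' =>
        simp only [Sym2.map_mk, Sym2.eq_iff] at h
        refine he₁ (Sym2.mk_isDiag_iff.2 ?_)
        rcases h with ⟨h1, h2⟩ | ⟨h1, h2⟩
        · exact hfg a a' b b' h1.symm h2.symm
        · exact hfg a a' b' b h2.symm h1.symm
  rcases this with h | h <;> simp only [SimpleGraph.edgeFactor, h, if_false] <;> ring

theorem SimpleGraph.card_embedding_eq_sum (F : SimpleGraph V) (H : SimpleGraph ι) :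
    (Nat.card (F ↪g H) : ℝ) = ∑ f : V ↪ ι, F.embIndicator f H := by
  classical
  unfold embIndicator
  rw [Finset.sum_boole, ← Fintype.card_subtype, ← Nat.card_eq_fintype_card]
  congr 1
  refine Nat.card_congr
    { toFun := fun φ => ⟨φ.toEmbedding, fun a b => φ.map_rel_iff.symm⟩
      invFun := fun f => ⟨f.1, fun {a b} => (f.2 a b).symm⟩
      left_inv := fun φ => by ext; rfl
      right_inv := fun f => by ext; rfl }

end EmbeddingIndicator

/-! ### The Hájek projection and its degenerate remainder -/

section HajekProjection

variable {V V' ι : Type*} [Fintype V] [DecidableEq V] [Fintype V'] [DecidableEq V'] [Fintype ι]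
  [DecidableEq ι]

namespace Graphon

/-- The projection of the induced weight on the sums of functions of one variable. -/
def hajek (W : Graphon) (F : SimpleGraph V) (z : V → I) : ℝ :=
  W.indDensity F + ∑ q, (rootedIntegral (W.indWeight F) q (z q) - W.indDensity F)

theorem abs_indDensity_le (W : Graphon) (F : SimpleGraph V) : |W.indDensity F| ≤ 1 :=
  abs_integral_le_of_bounded (W.abs_indWeight_le F)

theorem measurable_hajek (W : Graphon) (F : SimpleGraph V) : Measurable (W.hajek F) := by
  unfold hajek
  refine measurable_const.add (Finset.measurable_sum _ fun q _ => Measurable.sub ?_ (by fun_prop))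
  exact (measurable_rootedIntegral (W.measurable_indWeight F) q).comp (measurable_pi_apply q)

theorem abs_hajek_le (W : Graphon) (F : SimpleGraph V) (z : V → I) :
    |W.hajek F z| ≤ 1 + 2 * Fintype.card V := by
  unfold hajek
  refine (abs_add_le _ _).trans (add_le_add (W.abs_indDensity_le F) ?_)
  refine (Finset.abs_sum_le_sum_abs _ _).trans ?_
  have : ∀ q ∈ (Finset.univ : Finset V),
      |rootedIntegral (W.indWeight F) q (z q) - W.indDensity F| ≤ 2 := by
    intro q _
    refine (abs_sub _ _).trans ?_
    linarith [W.abs_indDensity_le F, abs_rootedIntegral_le (W.abs_indWeight_le F) q (z q)]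
  refine (Finset.sum_le_card_nsmul _ _ _ this).trans ?_
  rw [nsmul_eq_mul, mul_comm, Finset.card_univ]

theorem abs_indWeight_sub_hajek_le (W : Graphon) (F : SimpleGraph V) (z : V → I) :
    |W.indWeight F z - W.hajek F z| ≤ 2 + 2 * Fintype.card V := by
  refine (abs_sub _ _).trans ?_
  linarith [W.abs_indWeight_le F z, W.abs_hajek_le F z]

/-- Given the variable at q, the centered terms of `hajek` at other vertices integrate to zero, and
the term at q restores exactly the conditional expectation of the weight. -/
theorem rootedIntegral_sub_hajek (W : Graphon) (F : SimpleGraph V) (q : V) (u : I) :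
    rootedIntegral (fun z => W.indWeight F z - W.hajek F z) q u = 0 := by
  have hw := W.measurable_indWeight F
  have hb := W.abs_indWeight_le F
  have hr (q' : V) : Measurable fun v =>
      rootedIntegral (W.indWeight F) q' v - W.indDensity F :=
    (measurable_rootedIntegral hw q').sub measurable_const
  have hrb (q' : V) (v : I) : |rootedIntegral (W.indWeight F) q' v - W.indDensity F| ≤ 2 := by
    refine (abs_sub _ _).trans ?_
    linarith [W.abs_indDensity_le F, abs_rootedIntegral_le hb q' v]
  have h0 (q' : V) : ∫ v, (rootedIntegral (W.indWeight F) q' v - W.indDensity F) = 0 := by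
    rw [integral_sub (integrable_of_bounded (measurable_rootedIntegral hw q')
      (abs_rootedIntegral_le hb q')) (integrable_const _), integral_rootedIntegral q' hw hb]
    simp [indDensity]
  have h1 : rootedIntegral (W.hajek F) q u = rootedIntegral (W.indWeight F) q u := by
    have h2 := rootedIntegral_const_add_sum (W.indDensity F)
      (φ := fun q' z => rootedIntegral (W.indWeight F) q' (z q') - W.indDensity F)
      (fun q' => (hr q').comp (measurable_pi_apply q')) (fun q' z => hrb q' (z q')) q u
    refine h2.trans ?_
    rw [Finset.sum_eq_single q]
    · rw [rootedIntegral_eval_self (fun v => rootedIntegral (W.indWeight F) q v - W.indDensity F)]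
      ring
    · intro q' _ hq'
      exact (rootedIntegral_eval_of_ne (hr q') hq' u).trans (h0 q')
    · simp
  rw [rootedIntegral_sub hw (W.measurable_hajek F) hb (W.abs_hajek_le F), h1, sub_self]

theorem integral_sub_hajek (W : Graphon) (F : SimpleGraph V) :
    ∫ z, (W.indWeight F z - W.hajek F z) = 0 := by
  -- Without vertices there is no root to condition on; weight and projection then have the same
  -- integral directly.
  rcases isEmpty_or_nonempty V with h | ⟨⟨q⟩⟩
  · rw [integral_sub (integrable_of_bounded (W.measurable_indWeight F) (W.abs_indWeight_le F))
      (integrable_of_bounded (W.measurable_hajek F) (W.abs_hajek_le F))]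
    simp [hajek, indDensity]
  · rw [← integral_rootedIntegral q (φ := fun z => W.indWeight F z - W.hajek F z)
      ((W.measurable_indWeight F).sub (W.measurable_hajek F))
      (W.abs_indWeight_sub_hajek_le F)]
    simp [rootedIntegral_sub_hajek]

/-- With one shared variable, conditioning on it makes both factors vanish; with none, the integral
is a product of two zero means. -/
theorem integral_sub_hajek_mul (W : Graphon) (F : SimpleGraph V)
    (F' : SimpleGraph V') {f : V → ι} {g : V' → ι} (hf : Function.Injective f)
    (hg : Function.Injective g) (hfg : ∀ a a' b b', f a = g b → f a' = g b' → a = a') :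
    ∫ x : ι → I, (W.indWeight F (x ∘ f) - W.hajek F (x ∘ f)) *
      (W.indWeight F' (x ∘ g) - W.hajek F' (x ∘ g)) = 0 := by
  by_cases h : ∃ a b, f a = g b
  · obtain ⟨a, b, hab⟩ := h
    rw [integral_mul_comp_of_share_one hf hg hab (fun a' b' h => ?_)
      (φ := fun z => W.indWeight F z - W.hajek F z)
      (ψ := fun z => W.indWeight F' z - W.hajek F' z)
      ((W.measurable_indWeight F).sub (W.measurable_hajek F))
      ((W.measurable_indWeight F').sub (W.measurable_hajek F'))
      (W.abs_indWeight_sub_hajek_le F)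
      (W.abs_indWeight_sub_hajek_le F')]
    · simp [rootedIntegral_sub_hajek]
    · have := hfg a' a b' b h hab
      subst this
      exact hg (h.symm.trans hab)
  · push Not at h
    rw [integral_mul_comp_of_disjoint hf hg h
      (φ := fun z => W.indWeight F z - W.hajek F z)
      (ψ := fun z => W.indWeight F' z - W.hajek F' z)
      ((W.measurable_indWeight F).sub (W.measurable_hajek F))
      ((W.measurable_indWeight F').sub (W.measurable_hajek F'))
      (W.abs_indWeight_sub_hajek_le F)
      (W.abs_indWeight_sub_hajek_le F'), integral_sub_hajek, zero_mul]

end Graphon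

end HajekProjection

/-! ### Joint law of the random graph and the positions -/

section RandomGraph

variable {Ω : Type*} [MeasurableSpace Ω] {P : Measure Ω} [IsProbabilityMeasure P]
  {W : Graphon} {X : ℕ → Ω → I} {G : (n : ℕ) → Ω → SimpleGraph (Fin n)}

namespace IsWRandomGraphSequence

theorem map_positions (hG : IsWRandomGraphSequence W P X G) (n : ℕ) :
    P.map (fun ω (i : Fin n) => X i ω) = volume := by
  have h := hG.indep.precomp (g := fun i : Fin n => (i : ℕ)) Fin.val_injective
  have h' := (iIndepFun_iff_map_fun_eq_pi_map
    fun i => (hG.measurable_position _).aemeasurable).1 h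
  refine h'.trans (congrArg Measure.pi (funext fun i => ?_))
  exact hG.uniform i

theorem measurableSet_graph_eq (hG : IsWRandomGraphSequence W P X G) (n : ℕ)
    (H : SimpleGraph (Fin n)) : MeasurableSet {ω | G n ω = H} := by
  have h := SimpleGraph.measurable_iff_adj.1 (hG.measurable_graph n)
  have : {ω | G n ω = H} = ⋂ u, ⋂ v, {ω | (G n ω).Adj u v ↔ H.Adj u v} := by
    ext ω
    simp [SimpleGraph.ext_iff, funext_iff]
  rw [this]
  refine MeasurableSet.iInter fun u => MeasurableSet.iInter fun v => ?_
  by_cases huv : H.Adj u v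
  · simpa [huv] using h u v
  · simpa [huv] using (h u v).not

theorem map_restrict_graph (hG : IsWRandomGraphSequence W P X G) (n : ℕ)
    (H : SimpleGraph (Fin n)) :
    (P.restrict {ω | G n ω = H}).map (fun ω (i : Fin n) => X i ω) =
      volume.withDensity fun x => ENNReal.ofReal (W.indWeight H x) := by
  have hX : Measurable fun ω (i : Fin n) => X i ω :=
    measurable_pi_iff.2 fun i => hG.measurable_position i
  ext A hA
  rw [Measure.map_apply hX hA, Measure.restrict_apply (hX hA), withDensity_apply _ hA]
  have h := hG.conditional_law n H {x | (fun i : Fin n => x i) ∈ A}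
    (measurableSet_preimage (f := fun (x : ℕ → I) (i : Fin n) => x i) (by fun_prop) hA)
  have hm : Measurable fun x => ENNReal.ofReal (W.indWeight H x) :=
    (W.measurable_indWeight H).ennreal_ofReal
  rw [← hG.map_positions n, setLIntegral_map hA hm hX]
  rw [Set.inter_comm]
  exact h

/-- On each event {G n = H} the positions have density `indWeight H`, so expectations become
integrals over the cube of finite sums over graphs. -/
theorem integral_graph (hG : IsWRandomGraphSequence W P X G) (n : ℕ)
    {ψ : SimpleGraph (Fin n) → (Fin n → I) → ℝ} (hψ : ∀ H, Measurable (ψ H)) {C : ℝ}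
    (hC : ∀ H x, |ψ H x| ≤ C) :
    ∫ ω, ψ (G n ω) (fun i => X i ω) ∂P =
      ∫ x : Fin n → I, ∑ H, W.indWeight H x * ψ H x := by
  classical
  have hX : Measurable fun ω (i : Fin n) => X i ω :=
    measurable_pi_iff.2 fun i => hG.measurable_position i
  have h1 : ∀ ω, ψ (G n ω) (fun i => X i ω) =
      ∑ H, {ω | G n ω = H}.indicator (fun ω => ψ H (fun i => X i ω)) ω := by
    intro ω
    rw [Finset.sum_eq_single (G n ω)]
    · simp
    · intro H _ hH
      simp [hH.symm]
    · simp
  simp_rw [h1]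
  rw [integral_finsetSum, integral_finsetSum]
  · refine Finset.sum_congr rfl fun H _ => ?_
    rw [integral_indicator (hG.measurableSet_graph_eq n H),
      ← integral_map (φ := fun ω (i : Fin n) => X i ω) (f := ψ H) hX.aemeasurable
        (hψ H).aestronglyMeasurable, hG.map_restrict_graph,
      integral_withDensity_eq_integral_toReal_smul
        (W.measurable_indWeight H).ennreal_ofReal (by simp)]
    simp [ENNReal.toReal_ofReal (W.indWeight_nonneg H _)]
  · intro H _
    refine (integrable_of_bounded (hψ H) (hC H)).bdd_mul (c := 1)
      (W.measurable_indWeight H).aestronglyMeasurable (ae_of_all _ (W.abs_indWeight_le H))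
  · intro H _
    exact (integrable_of_bounded ((hψ H).comp hX) fun ω => hC H _).indicator
      (hG.measurableSet_graph_eq n H)

end IsWRandomGraphSequence
end RandomGraph

/-! ### Counting embeddings and overlapping pairs -/

section Counting

variable {V : Type*} [Fintype V] [DecidableEq V]

/-- Two values are prescribed and the others are free. Multiplying by n² avoids the exponent card V
- 2. -/
theorem card_functions_two_values (n : ℕ) {b b' : V} (hb : b ≠ b') (x y : Fin n) :
    (Finset.univ.filter fun g : V → Fin n => g b = x ∧ g b' = y).card * n ^ 2 =
      n ^ Fintype.card V := by
  have h : (Finset.univ.filter fun g : V → Fin n => g b = x ∧ g b' = y) =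
      Fintype.piFinset fun i => if i = b then {x} else if i = b' then {y} else Finset.univ := by
    ext g
    simp only [Finset.mem_filter, Finset.mem_univ, true_and, Fintype.mem_piFinset]
    constructor
    · rintro ⟨h1, h2⟩ i
      split_ifs with h3 h4
      · simp [h3, h1]
      · simp [h4, h2]
      · simp
    · intro h
      have h1 := h b
      have h2 := h b'
      simp only [if_true, hb.symm, if_false, Finset.mem_singleton] at h1 h2
      exact ⟨h1, h2⟩
  have h2 : n ^ 2 = (∏ i : V, if i = b then n else 1) * ∏ i : V, if i = b' then n else 1 := by
    simp [sq]
  rw [h, Fintype.card_piFinset, h2, ← Finset.prod_mul_distrib, ← Finset.prod_mul_distrib,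
    ← Finset.card_univ, ← Finset.prod_const]
  refine Finset.prod_congr rfl fun i _ => ?_
  by_cases h3 : i = b
  · subst h3; simp [hb]
  · by_cases h4 : i = b'
    · subst h4; simp [hb.symm]
    · simp [h3, h4]

open scoped Classical in
/-- The pairs of embeddings that share at least two vertices. -/
def overlappingPairs (V : Type*) [Fintype V] (n : ℕ) : Finset ((V ↪ Fin n) × (V ↪ Fin n)) :=
  Finset.univ.filter fun p => ∃ a a' b b', a ≠ a' ∧ p.1 a = p.2 b ∧ p.1 a' = p.2 b'

theorem mem_overlappingPairs {n : ℕ} {p : (V ↪ Fin n) × (V ↪ Fin n)} :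
    p ∈ overlappingPairs V n ↔ ∃ a a' b b', a ≠ a' ∧ p.1 a = p.2 b ∧ p.1 a' = p.2 b' := by
  simp [overlappingPairs]

theorem abs_sum_le_card_mul {κ : Type*} [Fintype κ] (s : Finset κ) {E : κ → ℝ} {C : ℝ}
    (hE : ∀ p, |E p| ≤ C) (h0 : ∀ p, p ∉ s → E p = 0) : ∑ p, E p ≤ s.card * C := by
  rw [← Finset.sum_subset (Finset.subset_univ s) fun p _ hp => h0 p hp, ← nsmul_eq_mul]
  exact Finset.sum_le_card_nsmul _ _ _ fun p _ => (le_abs_self _).trans (hE p)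

open scoped Classical in
-- Union bound over the positions (a, a', b, b') of two coincidences: at most (card V)⁴ choices,
-- each fixing two values of the second map. Injectivity serves only to ensure b ≠ b'; the count
-- itself is over arbitrary functions.
theorem card_overlappingPairs_le (n : ℕ) :
    (overlappingPairs V n).card * n ^ 2 ≤ Fintype.card V ^ 4 * n ^ (2 * Fintype.card V) := by
  let T : V × V × V × V → Finset ((V → Fin n) × (V → Fin n)) := fun t =>
    if t.2.2.1 ≠ t.2.2.2 then Finset.univ.filter fun p =>
      p.2 t.2.2.1 = p.1 t.1 ∧ p.2 t.2.2.2 = p.1 t.2.1 else ∅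
  have h1 : (overlappingPairs V n).card ≤ (Finset.univ.biUnion T).card := by
    refine Finset.card_le_card_of_injOn (fun p => (p.1, p.2)) ?_ ?_
    · rintro ⟨f, g⟩ hp
      simp only [overlappingPairs, Finset.coe_filter, Finset.mem_univ, true_and,
        Set.mem_ofPred_eq] at hp
      obtain ⟨a, a', b, b', ha, h1, h2⟩ := hp
      have hb : b ≠ b' := by
        rintro rfl
        exact ha (f.injective (h1.trans h2.symm))
      simp only [Finset.coe_biUnion, Set.mem_iUnion, Finset.mem_coe, Finset.mem_univ]
      exact ⟨(a, a', b, b'), trivial, by simp [T, hb, h1, h2]⟩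
    · rintro ⟨f, g⟩ _ ⟨f', g'⟩ _ h
      simpa using h
  have h2 : ∀ t, (T t).card * n ^ 2 ≤ n ^ (2 * Fintype.card V) := by
    rintro ⟨a, a', b, b'⟩
    by_cases hb : b = b'
    · simp [T, hb]
    · have : T (a, a', b, b') = (Finset.univ : Finset (V → Fin n)).biUnion fun f =>
          (Finset.univ.filter fun g : V → Fin n => g b = f a ∧ g b' = f a').image
            fun g => (f, g) := by
        ext ⟨f, g⟩
        simp [T, hb]
      rw [this]
      calc _ ≤ (∑ f : V → Fin n, (Finset.univ.filter fun g : V → Fin n =>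
            g b = f a ∧ g b' = f a').card) * n ^ 2 :=
          Nat.mul_le_mul_right _ (Finset.card_biUnion_le.trans
            (Finset.sum_le_sum fun f _ => Finset.card_image_le))
        _ = n ^ (2 * Fintype.card V) := by
          rw [Finset.sum_mul, Finset.sum_congr rfl fun f _ =>
            card_functions_two_values n hb (f a) (f a')]
          simp [two_mul, pow_add]
  calc (overlappingPairs V n).card * n ^ 2 ≤ (∑ t, (T t).card) * n ^ 2 :=
      Nat.mul_le_mul_right _ (h1.trans Finset.card_biUnion_le)
    _ ≤ ∑ _t : V × V × V × V, n ^ (2 * Fintype.card V) := by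
      rw [Finset.sum_mul]
      exact Finset.sum_le_sum fun t _ => h2 t
    _ = Fintype.card V ^ 4 * n ^ (2 * Fintype.card V) := by
      simp only [Finset.sum_const, Finset.card_univ, Fintype.card_prod, smul_eq_mul]
      ring

/-- The value of an embedding at a point is equidistributed. -/
theorem sum_embedding_apply (n : ℕ) (q : V) (φ : Fin n → ℝ) :
    n * ∑ f : V ↪ Fin n, φ (f q) = Fintype.card (V ↪ Fin n) * ∑ k, φ k := by
  classical
  -- Composition with the transposition of k and l matches the two fibers.
  have hc : ∀ (k l : Fin n), (Finset.univ.filter fun f : V ↪ Fin n => f q = k).card =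
      (Finset.univ.filter fun f : V ↪ Fin n => f q = l).card := by
    intro k l
    refine Finset.card_bij' (fun f _ => f.trans (Equiv.swap k l).toEmbedding)
      (fun f _ => f.trans (Equiv.swap k l).toEmbedding) ?_ ?_ ?_ ?_
    · intro f hf; simp_all
    · intro f hf; simp_all
    · intro f _; ext; simp
    · intro f _; ext; simp
  have hs : ∀ ψ : Fin n → ℝ, ∑ f : V ↪ Fin n, ψ (f q) =
      ∑ k, ((Finset.univ.filter fun f : V ↪ Fin n => f q = k).card : ℝ) * ψ k := by
    intro ψ
    rw [← Finset.sum_fiberwise (g := fun f : V ↪ Fin n => f q)]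
    refine Finset.sum_congr rfl fun k _ => ?_
    rw [Finset.sum_congr rfl fun f hf => by rw [(Finset.mem_filter.1 hf).2], Finset.sum_const,
      nsmul_eq_mul]
  rcases isEmpty_or_nonempty (Fin n) with h | ⟨⟨k₀⟩⟩
  · have : n = 0 := by
      by_contra hn
      exact h.elim ⟨0, Nat.pos_of_ne_zero hn⟩
    subst this
    simp
  · have hs' : ∀ ψ : Fin n → ℝ, ∑ f : V ↪ Fin n, ψ (f q) =
        ((Finset.univ.filter fun f : V ↪ Fin n => f q = k₀).card : ℝ) * ∑ k, ψ k := by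
      intro ψ
      rw [hs, Finset.mul_sum]
      exact Finset.sum_congr rfl fun k _ => by rw [hc k k₀]
    -- The constant function 1 identifies the common fiber size.
    have h1 := hs' fun _ => 1
    simp only [Finset.sum_const, Finset.card_univ, nsmul_eq_mul, mul_one, Fintype.card_fin] at h1
    rw [hs' φ, h1]
    ring

end Counting

/-! ### Second moment of the remainder -/

section SecondMoment

variable {V : Type*} [Fintype V] [DecidableEq V]
variable {Ω : Type*} [MeasurableSpace Ω] {P : Measure Ω} [IsProbabilityMeasure P]
  {W : Graphon} {X : ℕ → Ω → I} {G : (n : ℕ) → Ω → SimpleGraph (Fin n)}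

/-- The difference between an embedding indicator and its projection. -/
def Graphon.residual {n : ℕ} (W : Graphon) (F : SimpleGraph V) (f : V → Fin n)
    (H : SimpleGraph (Fin n)) (x : Fin n → I) : ℝ :=
  F.embIndicator f H - W.hajek F (x ∘ f)

theorem Graphon.measurable_residual {n : ℕ} (W : Graphon) (F : SimpleGraph V) (f : V → Fin n)
    (H : SimpleGraph (Fin n)) : Measurable (W.residual F f H) := by
  have := W.measurable_hajek F
  unfold residual
  exact measurable_const.sub (this.comp (measurable_pi_iff.2 fun v => measurable_pi_apply (f v)))

theorem Graphon.abs_residual_le {n : ℕ} (W : Graphon) (F : SimpleGraph V) (f : V → Fin n)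
    (H : SimpleGraph (Fin n)) (x : Fin n → I) :
    |W.residual F f H x| ≤ 2 + 2 * Fintype.card V := by
  refine (abs_sub _ _).trans ?_
  linarith [F.abs_embIndicator_le f H, W.abs_hajek_le F (x ∘ f)]

theorem Graphon.abs_residual_mul_le {n : ℕ} (W : Graphon) (F : SimpleGraph V) (f g : V → Fin n)
    (H : SimpleGraph (Fin n)) (x : Fin n → I) :
    |W.residual F f H x * W.residual F g H x| ≤ (2 + 2 * Fintype.card V) ^ 2 := by
  rw [abs_mul, sq]
  exact mul_le_mul (W.abs_residual_le F f H x) (W.abs_residual_le F g H x) (abs_nonneg _)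
    (by positivity)

namespace IsWRandomGraphSequence

theorem measurable_comp_graph (hG : IsWRandomGraphSequence W P X G) (n : ℕ) {β : Type*}
    [MeasurableSpace β] (φ : SimpleGraph (Fin n) → β) : Measurable fun ω => φ (G n ω) := by
  intro s _
  have : (fun ω => φ (G n ω)) ⁻¹' s = ⋃ H ∈ φ ⁻¹' s, {ω | G n ω = H} := by
    ext ω
    simp
  rw [this]
  exact MeasurableSet.biUnion (Set.to_countable _) fun H _ => hG.measurableSet_graph_eq n H

theorem measurable_comp_graph_positions (hG : IsWRandomGraphSequence W P X G) (n : ℕ)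
    {ψ : SimpleGraph (Fin n) → (Fin n → I) → ℝ} (hψ : ∀ H, Measurable (ψ H)) :
    Measurable fun ω => ψ (G n ω) fun i => X i ω := by
  classical
  have hX : Measurable fun ω (i : Fin n) => X i ω :=
    measurable_pi_iff.2 fun i => hG.measurable_position i
  have h1 : (fun ω => ψ (G n ω) fun i => X i ω) = fun ω =>
      ∑ H, {ω | G n ω = H}.indicator (fun ω => ψ H (fun i => X i ω)) ω := by
    funext ω
    rw [Finset.sum_eq_single (G n ω)]
    · simp
    · intro H _ hH
      simp [hH.symm]
    · simp
  rw [h1]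
  exact Finset.measurable_sum _ fun H _ => ((hψ H).comp hX).indicator
    (hG.measurableSet_graph_eq n H)

/-- Averaging over the edges first replaces each indicator by its conditional mean, even inside the
product since the pairs used are disjoint; the degeneracy of weight minus projection does the rest.
-/
theorem integral_residual_mul (hG : IsWRandomGraphSequence W P X G) (F : SimpleGraph V) {n : ℕ}
    {f g : V → Fin n} (hf : Function.Injective f)
    (hg : Function.Injective g) (hfg : ∀ a a' b b', f a = g b → f a' = g b' → a = a') :
    ∫ ω, W.residual F f (G n ω) (fun i => X i ω) * W.residual F g (G n ω) (fun i => X i ω) ∂P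
      = 0 := by
  rw [hG.integral_graph n (ψ := fun H x => W.residual F f H x * W.residual F g H x)
    (fun H => (W.measurable_residual F f H).mul (W.measurable_residual F g H))
    (W.abs_residual_mul_le F f g), ← W.integral_sub_hajek_mul F F hf hg hfg]
  refine integral_congr_ae (ae_of_all _ fun x => ?_)
  have h1 := W.sum_indWeight_mul_embIndicator_mul F F hf hg hfg x
  have h2 := W.sum_indWeight_mul_embIndicator F hf x
  have h3 := W.sum_indWeight_mul_embIndicator F hg x
  have h4 := W.sum_indWeight x
  calc ∑ H, W.indWeight H x * (W.residual F f H x * W.residual F g H x)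
      = ∑ H, W.indWeight H x * (F.embIndicator f H * F.embIndicator g H)
        - (∑ H, W.indWeight H x * F.embIndicator f H) * W.hajek F (x ∘ g)
        - (∑ H, W.indWeight H x * F.embIndicator g H) * W.hajek F (x ∘ f)
        + (∑ H, W.indWeight H x) * (W.hajek F (x ∘ f) * W.hajek F (x ∘ g)) := by
        simp only [Finset.sum_mul, ← Finset.sum_sub_distrib, ← Finset.sum_add_distrib]
        refine Finset.sum_congr rfl fun H _ => ?_
        simp only [Graphon.residual]
        ring
    _ = _ := by
        rw [h1, h2, h3, h4]
        ring

theorem integral_sum_residual_sq_le (hG : IsWRandomGraphSequence W P X G) (F : SimpleGraph V)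
    (n : ℕ) :
    (∫ ω, (∑ f : V ↪ Fin n, W.residual F f (G n ω) (fun i => X i ω)) ^ 2 ∂P) * n ^ 2 ≤
      (2 + 2 * Fintype.card V) ^ 2 * (Fintype.card V ^ 4 * n ^ (2 * Fintype.card V)) := by
  classical
  have hm (f g : V ↪ Fin n) : Measurable fun ω =>
      W.residual F f (G n ω) (fun i => X i ω) * W.residual F g (G n ω) (fun i => X i ω) :=
    hG.measurable_comp_graph_positions n (ψ := fun H x => W.residual F f H x * W.residual F g H x)
      fun H => (W.measurable_residual F f H).mul (W.measurable_residual F g H)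
  have h1 : ∫ ω, (∑ f : V ↪ Fin n, W.residual F f (G n ω) (fun i => X i ω)) ^ 2 ∂P =
      ∑ p : (V ↪ Fin n) × (V ↪ Fin n), ∫ ω,
        W.residual F p.1 (G n ω) (fun i => X i ω) * W.residual F p.2 (G n ω) (fun i => X i ω) ∂P := by
    rw [← integral_finsetSum _ fun p _ => integrable_of_bounded (hm p.1 p.2)
      fun ω => W.abs_residual_mul_le F p.1 p.2 _ _]
    simp_rw [sq, Finset.sum_mul_sum, Fintype.sum_prod_type]
  have h2 : ∑ p : (V ↪ Fin n) × (V ↪ Fin n), ∫ ω,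
        W.residual F p.1 (G n ω) (fun i => X i ω) * W.residual F p.2 (G n ω) (fun i => X i ω) ∂P
      ≤ (overlappingPairs V n).card * (2 + 2 * Fintype.card V : ℝ) ^ 2 := by
    refine abs_sum_le_card_mul _ (fun p => abs_integral_le_of_bounded fun ω =>
      W.abs_residual_mul_le F p.1 p.2 _ _) fun p hp => ?_
    refine hG.integral_residual_mul F p.1.injective p.2.injective fun a a' b b' h h' => ?_
    by_contra ha
    exact hp (mem_overlappingPairs.2 ⟨a, a', b, b', ha, h, h'⟩)
  have h3 : ((overlappingPairs V n).card : ℝ) * n ^ 2 ≤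
      Fintype.card V ^ 4 * n ^ (2 * Fintype.card V) := by
    exact_mod_cast card_overlappingPairs_le (V := V) n
  rw [h1]
  calc _ ≤ (overlappingPairs V n).card * (2 + 2 * Fintype.card V : ℝ) ^ 2 * n ^ 2 := by gcongr
    _ = (2 + 2 * Fintype.card V : ℝ) ^ 2 * ((overlappingPairs V n).card * n ^ 2) := by ring
    _ ≤ _ := by gcongr

end IsWRandomGraphSequence

/-- The remainder in the approximation of the fluctuations of the induced density by a normalized
sum of independent random variables. -/
def Graphon.remainder (W : Graphon) (F : SimpleGraph V) (X : ℕ → Ω → I)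
    (G : (n : ℕ) → Ω → SimpleGraph (Fin n)) (n : ℕ) (ω : Ω) : ℝ :=
  √n * (F.indDensity (G n ω) - W.indDensity F) -
    (√n)⁻¹ * (∑ k ∈ Finset.range n, W.indProjection F (X k ω) -
      n * (Fintype.card V * W.indDensity F))

/-- Averaging `hajek` over all embeddings turns each one-variable term into an empirical mean of the
positions, by equidistribution of f q. The bound on `Fintype.card V` keeps the falling factorial
nonzero. -/
theorem Graphon.remainder_eq (W : Graphon) (F : SimpleGraph V) (X : ℕ → Ω → I)
    (G : (n : ℕ) → Ω → SimpleGraph (Fin n)) {n : ℕ} (hn : 0 < n) (hV : Fintype.card V ≤ n) (ω : Ω) :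
    W.remainder F X G n ω = √n / n.descFactorial (Fintype.card V) *
      ∑ f : V ↪ Fin n, W.residual F f (G n ω) (fun i => X i ω) := by
  have hA : (n.descFactorial (Fintype.card V) : ℝ) ≠ 0 := by
    exact_mod_cast (Nat.descFactorial_pos.2 hV).ne'
  have hn' : (0 : ℝ) < n := by exact_mod_cast hn
  have hcard : Fintype.card (V ↪ Fin n) = n.descFactorial (Fintype.card V) := by
    simp [Fintype.card_embedding_eq]
  have h1 : ∑ f : V ↪ Fin n, W.hajek F ((fun i : Fin n => X i ω) ∘ f) =
      n.descFactorial (Fintype.card V) * (W.indDensity F +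
        (∑ k ∈ Finset.range n, W.indProjection F (X k ω) -
      n * (Fintype.card V * W.indDensity F)) / n) := by
    have h2 : ∀ q, ∑ f : V ↪ Fin n, (rootedIntegral (W.indWeight F) q (X (f q) ω) -
        W.indDensity F) = n.descFactorial (Fintype.card V) *
        ((∑ k ∈ Finset.range n, rootedIntegral (W.indWeight F) q (X k ω)) / n - W.indDensity F) := by
      intro q
      have h3 := sum_embedding_apply n q
        (fun k => rootedIntegral (W.indWeight F) q (X k ω) - W.indDensity F)
      rw [hcard, Finset.sum_sub_distrib (s := (Finset.univ : Finset (Fin n))),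
        Fin.sum_univ_eq_sum_range (fun k => rootedIntegral (W.indWeight F) q (X k ω))] at h3
      simp only [Finset.sum_const, Finset.card_univ, Fintype.card_fin, nsmul_eq_mul] at h3
      field_simp
      linarith
    simp only [hajek, Function.comp_apply]
    rw [Finset.sum_add_distrib, Finset.sum_comm, Finset.sum_congr rfl fun q _ => h2 q,
      ← Finset.mul_sum, Finset.sum_sub_distrib, ← Finset.sum_div, Finset.sum_comm]
    simp only [Finset.sum_const, Finset.card_univ, hcard, nsmul_eq_mul, indProjection_eq]
    field_simp
  have h2 : ∑ f : V ↪ Fin n, W.residual F f (G n ω) (fun i => X i ω) =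
      n.descFactorial (Fintype.card V) * (F.indDensity (G n ω) - (W.indDensity F +
        (∑ k ∈ Finset.range n, W.indProjection F (X k ω) -
      n * (Fintype.card V * W.indDensity F)) / n)) := by
    simp only [residual]
    rw [Finset.sum_sub_distrib, h1, SimpleGraph.indDensity, F.card_embedding_eq_sum,
      Fintype.card_fin]
    field_simp
  rw [h2, remainder]
  have hs : √(n : ℝ) * √n = n := Real.mul_self_sqrt hn'.le
  have hs0 : √(n : ℝ) ≠ 0 := (Real.sqrt_pos.2 hn').ne'
  generalize (∑ k ∈ Finset.range n, W.indProjection F (X k ω) -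
      n * (Fintype.card V * W.indDensity F)) = S
  have : S / n = S / (√n * √n) := by rw [hs]
  rw [this]
  field_simp
  ring

theorem IsWRandomGraphSequence.integral_remainder_sq_le (hG : IsWRandomGraphSequence W P X G)
    (F : SimpleGraph V) {n : ℕ} (hn : 0 < n) (hV : 2 * Fintype.card V ≤ n) :
    ∫ ω, W.remainder F X G n ω ^ 2 ∂P ≤
      (2 + 2 * Fintype.card V) ^ 2 * Fintype.card V ^ 4 * 4 ^ Fintype.card V / n := by
  have hV' : Fintype.card V ≤ n := by omega
  have hn' : (0 : ℝ) < n := by exact_mod_cast hn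
  have hA : (0 : ℝ) < n.descFactorial (Fintype.card V) := by
    exact_mod_cast Nat.descFactorial_pos.2 hV'
  -- Since 2p ≤ n, each factor of the falling factorial is at least n + 1 - p ≥ n / 2. Squaring this
  -- comparison produces the constant 4^p.
  have hA2 : (n : ℝ) ^ Fintype.card V ≤ 2 ^ Fintype.card V * n.descFactorial (Fintype.card V) := by
    have h1 : n ^ Fintype.card V ≤ 2 ^ Fintype.card V * n.descFactorial (Fintype.card V) :=
      calc n ^ Fintype.card V ≤ (2 * (n + 1 - Fintype.card V)) ^ Fintype.card V :=
            Nat.pow_le_pow_left (by omega) _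
        _ = 2 ^ Fintype.card V * (n + 1 - Fintype.card V) ^ Fintype.card V := mul_pow _ _ _
        _ ≤ _ := Nat.mul_le_mul_left _ (Nat.pow_sub_le_descFactorial _ _)
    exact_mod_cast h1
  simp_rw [W.remainder_eq F X G hn hV', mul_pow]
  rw [integral_const_mul, div_pow, Real.sq_sqrt hn'.le]
  have h := hG.integral_sum_residual_sq_le F n
  generalize ∫ ω, (∑ f : V ↪ Fin n, W.residual F f (G n ω) (fun i => X i ω)) ^ 2 ∂P = E at h ⊢
  generalize (n.descFactorial (Fintype.card V) : ℝ) = A at hA hA2 ⊢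
  have h4 : (n : ℝ) ^ (2 * Fintype.card V) ≤ 4 ^ Fintype.card V * A ^ 2 := by
    calc (n : ℝ) ^ (2 * Fintype.card V) = ((n : ℝ) ^ Fintype.card V) ^ 2 := by
          rw [← pow_mul, mul_comm]
      _ ≤ (2 ^ Fintype.card V * A) ^ 2 := by gcongr
      _ = 4 ^ Fintype.card V * A ^ 2 := by
          rw [mul_pow, ← pow_mul, mul_comm (Fintype.card V), pow_mul]; norm_num
  rw [le_div_iff₀ hn', div_mul_eq_mul_div, div_mul_eq_mul_div, div_le_iff₀ (by positivity)]
  calc (n : ℝ) * E * n = E * n ^ 2 := by ring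
    _ ≤ _ := h
    _ ≤ (2 + 2 * Fintype.card V) ^ 2 * (Fintype.card V ^ 4 * (4 ^ Fintype.card V * A ^ 2)) := by
      gcongr
    _ = _ := by ring

theorem IsWRandomGraphSequence.tendsto_integral_remainder_sq
    (hG : IsWRandomGraphSequence W P X G) (F : SimpleGraph V) :
    Tendsto (fun n => ∫ ω, W.remainder F X G n ω ^ 2 ∂P) atTop (nhds 0) := by
  refine squeeze_zero' (Eventually.of_forall fun n => integral_nonneg fun ω => sq_nonneg _) ?_
    (tendsto_const_div_atTop_nhds_zero_nat
      ((2 + 2 * Fintype.card V : ℝ) ^ 2 * Fintype.card V ^ 4 * 4 ^ Fintype.card V))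
  filter_upwards [eventually_gt_atTop 0, eventually_ge_atTop (2 * Fintype.card V)] with n h1 h2
  exact hG.integral_remainder_sq_le F h1 h2

end SecondMoment

/-! ### Existence of the limiting Gaussian process -/

section GaussianExistence

open InnerProductSpace

/-- The expansion of `v n` along the normalized Gram-Schmidt system. -/
theorem eq_sum_gramSchmidtNormed {E : Type*} [NormedAddCommGroup E] [InnerProductSpace ℝ E]
    (v : ℕ → E) (n : ℕ) : v n = ∑ k ∈ Finset.range (n + 1),
      inner ℝ (gramSchmidtNormed ℝ v k) (v n) • gramSchmidtNormed ℝ v k := by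
  rw [Finset.sum_range_succ, add_comm]
  conv_lhs => rw [gramSchmidt_def'' ℝ v n]
  have h1 : Finset.Iio n = Finset.range n := by ext; simp
  rw [h1]
  congr 1
  · have : inner ℝ (gramSchmidt ℝ v n) (v n) = inner ℝ (gramSchmidt ℝ v n) (gramSchmidt ℝ v n) := by
      conv_lhs => rw [gramSchmidt_def'' ℝ v n]
      rw [inner_add_right, inner_sum, Finset.sum_eq_zero, add_zero]
      intro k hk
      rw [inner_smul_right, gramSchmidt_orthogonal ℝ v (Finset.mem_Iio.1 hk).ne', mul_zero]
    simp only [gramSchmidtNormed, inner_smul_left, this, real_inner_self_eq_norm_sq, smul_smul]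
    -- If v n depends linearly on its predecessors, its orthogonal part and the normalized vector
    -- are both zero.
    by_cases h : gramSchmidt ℝ v n = 0
    · simp [h]
    · have : ‖gramSchmidt ℝ v n‖ ≠ 0 := norm_ne_zero_iff.2 h
      have h2 : (starRingEnd ℝ) ((‖gramSchmidt ℝ v n‖ : ℝ)⁻¹) * ‖gramSchmidt ℝ v n‖ ^ 2 *
        (‖gramSchmidt ℝ v n‖ : ℝ)⁻¹ = 1 := by
        simp only [conj_trivial]
        field_simp
      simp only [RCLike.ofReal_real_eq_id, id]
      rw [h2, one_smul]
  · refine Finset.sum_congr rfl fun k _ => ?_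
    simp only [gramSchmidtNormed, inner_smul_left, smul_smul, conj_trivial,
      RCLike.ofReal_real_eq_id, id]
    congr 1
    ring

theorem inner_eq_sum_gramSchmidtNormed {E : Type*} [NormedAddCommGroup E] [InnerProductSpace ℝ E]
    (v : ℕ → E) (n m : ℕ) : inner ℝ (v n) (v m) =
      ∑ k ∈ Finset.range (n + 1), ∑ l ∈ Finset.range (m + 1),
        inner ℝ (gramSchmidtNormed ℝ v k) (v n) * inner ℝ (gramSchmidtNormed ℝ v l) (v m) *
          if k = l then 1 else 0 := by
  have ho : ∀ k l, k ≠ l →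
      inner ℝ (gramSchmidtNormed ℝ v k) (gramSchmidtNormed ℝ v l) = (0 : ℝ) := by
    intro k l h
    simp [gramSchmidtNormed, inner_smul_left, inner_smul_right, gramSchmidt_orthogonal ℝ v h]
  conv_lhs => rw [eq_sum_gramSchmidtNormed v n, eq_sum_gramSchmidtNormed v m]
  rw [sum_inner]
  refine Finset.sum_congr rfl fun k _ => ?_
  rw [inner_sum]
  refine Finset.sum_congr rfl fun l _ => ?_
  rw [inner_smul_left, inner_smul_right]
  split_ifs with h
  · subst h
    -- The system is orthonormal except for zero vectors, whose coefficients vanish; the Kronecker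
    -- delta is therefore correct in all cases.
    by_cases h0 : gramSchmidtNormed ℝ v k = 0
    · simp [h0]
    · rw [real_inner_self_eq_norm_sq, gramSchmidtNormed_unit_length' h0]
      simp
  · simp [ho k l h]

/-- There is a centered Gaussian sequence with any given Gram matrix as covariance. -/
theorem exists_gaussianProcess_inner {E : Type*} [NormedAddCommGroup E] [InnerProductSpace ℝ E]
    (v : ℕ → E) : ∃ (P' : Measure (ℕ → ℝ)) (_ : IsProbabilityMeasure P')
      (Θ : ℕ → (ℕ → ℝ) → ℝ), IsGaussianProcess Θ P' ∧ (∀ n, ∫ ω, Θ n ω ∂P' = 0) ∧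
        ∀ n m, cov[Θ n, Θ m; P'] = inner ℝ (v n) (v m) := by
  let P' : Measure (ℕ → ℝ) := Measure.infinitePi fun _ => gaussianReal 0 1
  let ξ : ℕ → (ℕ → ℝ) → ℝ := fun k ω => ω k
  have hlaw : ∀ k, HasLaw (ξ k) (gaussianReal 0 1) P' := fun k =>
    ⟨by fun_prop, (measurePreserving_eval_infinitePi (fun _ : ℕ => gaussianReal 0 1) k).map_eq⟩
  have hgauss : ∀ k, HasGaussianLaw (ξ k) P' := fun k => (hlaw k).hasGaussianLaw
  have hind : iIndepFun ξ P' :=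
    iIndepFun_infinitePi (P := fun _ : ℕ => gaussianReal 0 1) (X := fun _ ω => ω) (by fun_prop)
  have hξ : IsGaussianProcess ξ P' :=
    ⟨fun S => (hind.restrict S).hasGaussianLaw fun k => hgauss k⟩
  have hL2 : ∀ k, MemLp (ξ k) 2 P' := fun k => (hgauss k).memLp_two
  have hmean : ∀ k, ∫ ω, ξ k ω ∂P' = 0 := fun k => by
    rw [(hlaw k).integral_eq, integral_id_gaussianReal]
  have hcov : ∀ k l, cov[ξ k, ξ l; P'] = if k = l then 1 else 0 := by
    intro k l
    split_ifs with h
    · subst h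
      rw [covariance_self (hlaw k).aemeasurable, (hlaw k).variance_eq]
      simp
    · exact (hind.indepFun h).covariance_eq_zero (hL2 k) (hL2 l)
  let c : ℕ → ℕ → ℝ := fun n k => inner ℝ (gramSchmidtNormed ℝ v k) (v n)
  refine ⟨P', inferInstance, fun n ω => ∑ k ∈ Finset.range (n + 1), c n k * ξ k ω, ?_, ?_, ?_⟩
  · refine hξ.of_isGaussianProcess fun n => ⟨Finset.range (n + 1),
      ∑ k : Finset.range (n + 1), c n k • ContinuousLinearMap.proj k, fun ω => ?_⟩
    simp only [_root_.sum_apply, _root_.smul_apply,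
      ContinuousLinearMap.proj_apply, smul_eq_mul]
    exact (Finset.sum_coe_sort (Finset.range (n + 1)) fun k => c n k * ξ k ω).symm
  · intro n
    rw [integral_finsetSum _ fun k _ => ((hL2 k).integrable (by norm_num)).const_mul _]
    simp [integral_const_mul, hmean]
  · intro n m
    rw [covariance_fun_sum_fun_sum' (fun k _ => (hL2 k).const_mul _)
      (fun k _ => (hL2 k).const_mul _), inner_eq_sum_gramSchmidtNormed]
    refine Finset.sum_congr rfl fun k _ => Finset.sum_congr rfl fun l _ => ?_
    rw [covariance_const_mul_left, covariance_const_mul_right, hcov, mul_assoc]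

/-- Covariances of square integrable functions are inner products. -/
theorem exists_gaussianProcess_covariance {T β : Type*} [Countable T] [MeasurableSpace β]
    (μ : Measure β) [IsProbabilityMeasure μ] {h : T → β → ℝ} (hh : ∀ t, MemLp (h t) 2 μ) :
    ∃ (P' : Measure (ℕ → ℝ)) (_ : IsProbabilityMeasure P')
      (Θ : T → (ℕ → ℝ) → ℝ), IsGaussianProcess Θ P' ∧ (∀ t, ∫ ω, Θ t ω ∂P' = 0) ∧
        ∀ s t, cov[Θ s, Θ t; P'] = cov[h s, h t; μ] := by
  obtain ⟨e, he⟩ := exists_injective_nat T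
  have hc : ∀ t, MemLp (fun x => h t x - ∫ y, h t y ∂μ) 2 μ := fun t =>
    (hh t).sub (memLp_const _)
  let v : T → Lp ℝ 2 μ := fun t => (hc t).toLp
  have hv : ∀ s t, inner ℝ (v s) (v t) = cov[h s, h t; μ] := by
    intro s t
    rw [L2.inner_def, covariance]
    refine integral_congr_ae ?_
    filter_upwards [(hc s).coeFn_toLp, (hc t).coeFn_toLp] with x hs ht
    simp only [v, hs, ht, RCLike.inner_apply, conj_trivial]
    ring
  obtain ⟨P', hP', Θ, h1, h2, h3⟩ := exists_gaussianProcess_inner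
    -- The countable index set is placed inside ℕ, with the zero vector at unused indices.
    (Function.extend e v 0)
  refine ⟨P', hP', fun t => Θ (e t), h1.comp_right e, fun t => h2 _, fun s t => ?_⟩
  rw [h3, he.extend_apply, he.extend_apply, hv]

instance : Countable FinGraph := by
  unfold FinGraph
  infer_instance

end GaussianExistence

/-! ### The Cramér-Wold device through characteristic functions -/

section CramerWold

variable {Ω Ω' S : Type*} [MeasurableSpace Ω] [MeasurableSpace Ω'] [Fintype S]
  {P : Measure Ω} [IsProbabilityMeasure P] {P' : Measure Ω'} [IsProbabilityMeasure P']

/-- The characteristic function of a vector at t only sees the scalar ⟨t, Y⟩. The passage to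
`EuclideanSpace` supplies the inner product. -/
theorem charFun_map_toLp {μ : Measure Ω} {Y : Ω → S → ℝ} (hY : AEMeasurable Y μ)
    (t : EuclideanSpace ℝ S) :
    charFun (μ.map fun ω => (WithLp.toLp 2 (Y ω) : EuclideanSpace ℝ S)) t =
      charFun (μ.map fun ω => ∑ s, t s * Y ω s) 1 := by
  have hm : Measurable (WithLp.toLp 2 : (S → ℝ) → EuclideanSpace ℝ S) := by fun_prop
  rw [charFun_apply, charFun_apply, integral_map (φ := fun ω => (WithLp.toLp 2 (Y ω) : EuclideanSpace ℝ S))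
      (hm.comp_aemeasurable hY) (by fun_prop),
    integral_map (by fun_prop) (by fun_prop)]
  simp [PiLp.inner_apply]

/-- The **Cramér-Wold device**. -/
theorem tendstoInDistribution_pi {Y : ℕ → Ω → S → ℝ} {Z : Ω' → S → ℝ}
    (hY : ∀ n, AEMeasurable (Y n) P) (hZ : AEMeasurable Z P')
    (h : ∀ t : S → ℝ, TendstoInDistribution (fun n ω => ∑ s, t s * Y n ω s) atTop
      (fun ω => ∑ s, t s * Z ω s) (fun _ => P) P') :
    TendstoInDistribution Y atTop Z (fun _ => P) P' := by
  have hm : Measurable (WithLp.toLp 2 : (S → ℝ) → EuclideanSpace ℝ S) := by fun_prop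
  have key : TendstoInDistribution (fun n ω => WithLp.toLp 2 (Y n ω) : ℕ → Ω → EuclideanSpace ℝ S)
      atTop (fun ω => WithLp.toLp 2 (Z ω)) (fun _ => P) P' := by
    refine ⟨fun n => hm.comp_aemeasurable (hY n), hm.comp_aemeasurable hZ, ?_⟩
    refine ProbabilityMeasure.tendsto_iff_tendsto_charFun.2 fun t => ?_
    have h1 := ProbabilityMeasure.tendsto_iff_tendsto_charFun.1 (h t).tendsto 1
    simp only [ProbabilityMeasure.coe_mk] at h1 ⊢
    rw [charFun_map_toLp hZ t]
    exact h1.congr fun n => (charFun_map_toLp (hY n) t).symm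
  exact key.continuous_comp (g := fun x : EuclideanSpace ℝ S => (x : S → ℝ)) (by fun_prop)

end CramerWold

/-! ### Asymptotic normality of linear combinations -/

section Fluctuations

variable {V : Type*} [Fintype V] [DecidableEq V]
variable {Ω : Type*} [MeasurableSpace Ω] {P : Measure Ω} [IsProbabilityMeasure P]
  {W : Graphon} {X : ℕ → Ω → I} {G : (n : ℕ) → Ω → SimpleGraph (Fin n)}

namespace Graphon

theorem measurable_indProjection (W : Graphon) (F : SimpleGraph V) :
    Measurable (W.indProjection F) := by
  rw [funext (W.indProjection_eq F)]
  exact Finset.measurable_sum _ fun q _ => measurable_rootedIntegral (W.measurable_indWeight F) q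

theorem abs_indProjection_le (W : Graphon) (F : SimpleGraph V) (u : I) :
    |W.indProjection F u| ≤ Fintype.card V := by
  rw [indProjection_eq]
  refine (Finset.abs_sum_le_sum_abs _ _).trans ?_
  refine (Finset.sum_le_card_nsmul _ _ 1 fun q _ =>
    abs_rootedIntegral_le (W.abs_indWeight_le F) q u).trans ?_
  simp

theorem memLp_indProjection (W : Graphon) (F : SimpleGraph V) :
    MemLp (W.indProjection F) 2 volume :=
  MemLp.of_bound (W.measurable_indProjection F).aestronglyMeasurable _
    (ae_of_all _ (W.abs_indProjection_le F))

theorem integral_indProjection (W : Graphon) (F : SimpleGraph V) :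
    ∫ u, W.indProjection F u = Fintype.card V * W.indDensity F := by
  have hr := fun q => measurable_rootedIntegral (W.measurable_indWeight F) q
  simp_rw [indProjection_eq]
  rw [integral_finsetSum _ fun q _ => integrable_of_bounded (hr q)
    (abs_rootedIntegral_le (W.abs_indWeight_le F) q)]
  simp_rw [integral_rootedIntegral _ (W.measurable_indWeight F) (W.abs_indWeight_le F)]
  simp [indDensity]

end Graphon

theorem eLpNorm_sum_const_mul_le {κ : Type*} [Fintype κ] (t : κ → ℝ) {f : κ → Ω → ℝ}
    (hf : ∀ k, AEStronglyMeasurable (f k) P) :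
    eLpNorm (fun ω => ∑ k, t k * f k ω) 2 P ≤ ∑ k, ‖t k‖ₑ * eLpNorm (f k) 2 P := by
  have h1 := eLpNorm_sum_le (s := Finset.univ) (f := fun k => t k • f k)
    (fun k _ => (hf k).const_smul (t k)) (p := 2) (by norm_num)
  have h2 : (∑ k, t k • f k) = fun ω => ∑ k, t k * f k ω := by
    ext ω; simp
  rw [h2] at h1
  exact h1.trans (Finset.sum_le_sum fun k _ => eLpNorm_const_smul_le)

namespace IsWRandomGraphSequence

theorem measurePreserving_position (hG : IsWRandomGraphSequence W P X G) (i : ℕ) :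
    MeasurePreserving (X i) P volume :=
  ⟨hG.measurable_position i, hG.uniform i⟩

theorem memLp_indDensity (hG : IsWRandomGraphSequence W P X G) (F : SimpleGraph V) (n : ℕ) :
    MemLp (fun ω => F.indDensity (G n ω)) 2 P := by
  classical
  refine MemLp.of_bound (hG.measurable_comp_graph n F.indDensity).aestronglyMeasurable
    -- A crude bound depending on n suffices: there are finitely many graphs on [n].
    (∑ H : SimpleGraph (Fin n), |F.indDensity H|) (ae_of_all _ fun ω => ?_)
  exact Finset.single_le_sum (f := fun H : SimpleGraph (Fin n) => |F.indDensity H|)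
    (fun H _ => abs_nonneg _) (Finset.mem_univ (G n ω))

theorem memLp_remainder (hG : IsWRandomGraphSequence W P X G) (F : SimpleGraph V) (n : ℕ) :
    MemLp (W.remainder F X G n) 2 P := by
  have h1 := ((hG.memLp_indDensity F n).sub (memLp_const (W.indDensity F))).const_mul √n
  have h2 : MemLp (fun ω => ∑ k ∈ Finset.range n, W.indProjection F (X k ω)) 2 P :=
    memLp_finsetSum _ fun k _ =>
      (W.memLp_indProjection F).comp_measurePreserving (hG.measurePreserving_position k)
  exact h1.sub ((h2.sub (memLp_const (n * (Fintype.card V * W.indDensity F)))).const_mul (√n)⁻¹)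

theorem tendsto_eLpNorm_remainder (hG : IsWRandomGraphSequence W P X G) (F : SimpleGraph V) :
    Tendsto (fun n => eLpNorm (W.remainder F X G n) 2 P) atTop (nhds 0) := by
  have h : ∀ n, eLpNorm (W.remainder F X G n) 2 P =
      ENNReal.ofReal (√(∫ ω, W.remainder F X G n ω ^ 2 ∂P)) := by
    intro n
    rw [(hG.memLp_remainder F n).eLpNorm_eq_integral_rpow_norm (by norm_num) (by norm_num)]
    simp [Real.sqrt_eq_rpow]
  simp_rw [h]
  have h1 := (Real.continuous_sqrt.tendsto 0).comp (hG.tendsto_integral_remainder_sq F)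
  rw [Real.sqrt_zero] at h1
  have h2 := (ENNReal.continuous_ofReal.tendsto 0).comp h1
  rw [ENNReal.ofReal_zero] at h2
  exact h2

theorem tendstoInMeasure_sum_remainder (hG : IsWRandomGraphSequence W P X G)
    (S : Finset FinGraph) (t : S → ℝ) :
    TendstoInMeasure P (fun n ω => ∑ s : S, t s * W.remainder s.1.2 X G n ω) atTop 0 := by
  have hL : ∀ n (s : S), MemLp (fun ω => t s * W.remainder s.1.2 X G n ω) 2 P := fun n s =>
    (hG.memLp_remainder s.1.2 n).const_mul (t s)
  refine tendstoInMeasure_of_tendsto_eLpNorm (p := 2) (by norm_num)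
    (fun n => (memLp_finsetSum _ fun s _ => hL n s).aestronglyMeasurable)
    aestronglyMeasurable_zero ?_
  have hb : ∀ n, eLpNorm ((fun ω => ∑ s : S, t s * W.remainder s.1.2 X G n ω) - 0) 2 P ≤
      ∑ s : S, ‖t s‖ₑ * eLpNorm (W.remainder s.1.2 X G n) 2 P := by
    intro n
    rw [sub_zero]
    exact eLpNorm_sum_const_mul_le t fun s => (hG.memLp_remainder s.1.2 n).aestronglyMeasurable
  refine tendsto_of_tendsto_of_tendsto_of_le_of_le tendsto_const_nhds ?_ (fun _ => zero_le) hb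
  have : Tendsto (fun n => ∑ s : S, ‖t s‖ₑ * eLpNorm (W.remainder s.1.2 X G n) 2 P) atTop
      (nhds (∑ s : S, ‖t s‖ₑ * 0)) :=
    tendsto_finsetSum _ fun s _ => ENNReal.Tendsto.const_mul (hG.tendsto_eLpNorm_remainder s.1.2)
      (.inr (by simp))
  simpa using this

/-- Linear combinations of the fluctuations of the induced densities are asymptotically normal. -/
theorem tendstoInDistribution_sum (hG : IsWRandomGraphSequence W P X G)
    {Ω' : Type*} [MeasurableSpace Ω'] {P' : Measure Ω'} [IsProbabilityMeasure P']
    {Θ : FinGraph → Ω' → ℝ} (hΘ : IsGaussianProcess Θ P') (hmean : ∀ F, ∫ ω', Θ F ω' ∂P' = 0)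
    (hcov : ∀ F₁ F₂, cov[Θ F₁, Θ F₂; P'] = W.indCovariance F₁ F₂)
    (S : Finset FinGraph) (t : S → ℝ) :
    TendstoInDistribution (fun (n : ℕ) ω => ∑ s : S, t s *
        (√n * (s.1.2.indDensity (G n ω) - W.indDensity s.1.2))) atTop
      (fun ω' => ∑ s : S, t s * Θ s.1 ω') (fun _ => P) P' := by
  let g : I → ℝ := fun u => ∑ s : S, t s * W.indProjection s.1.2 u
  have hgL : MemLp g 2 volume :=
    memLp_finsetSum _ fun s _ => (W.memLp_indProjection s.1.2).const_mul (t s)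
  have hgm : Measurable g := Finset.measurable_sum _ fun s _ =>
    (W.measurable_indProjection s.1.2).const_mul (t s)
  have hΘL : ∀ F, MemLp (Θ F) 2 P' := fun F => (hΘ.hasGaussianLaw_eval F).memLp_two
  have hX0 := hG.measurePreserving_position
  -- By bilinearity, equality of the two covariance functions gives equality of the variances of all
  -- linear combinations.
  have hvar : Var[fun ω' => ∑ s : S, t s * Θ s.1 ω'; P'] = Var[g ∘ X 0; P] := by
    have h1 : Var[g ∘ X 0; P] = Var[g; volume] := by
      rw [← (hX0 0).map_eq, variance_map (hgm.aemeasurable) (hX0 0).measurable.aemeasurable]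
    rw [h1, ← covariance_self hgm.aemeasurable,
      ← covariance_self (memLp_finsetSum _ fun s _ =>
        (hΘL s.1).const_mul (t s)).aestronglyMeasurable.aemeasurable,
      covariance_fun_sum_fun_sum (fun s : S => (hΘL s.1).const_mul (t s))
        fun s : S => (hΘL s.1).const_mul (t s),
      covariance_fun_sum_fun_sum (fun s : S => (W.memLp_indProjection s.1.2).const_mul (t s))
        fun s : S => (W.memLp_indProjection s.1.2).const_mul (t s)]
    simp only [covariance_const_mul_left, covariance_const_mul_right, hcov]
    rfl
  have hgauss : HasGaussianLaw (fun ω' => ∑ s : S, t s * Θ s.1 ω') P' := by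
    have h := hΘ.hasGaussianLaw S
    have h2 := h.map (∑ s : S, t s • ContinuousLinearMap.proj s : (S → ℝ) →L[ℝ] ℝ)
    convert! h2 using 1
    ext ω'
    simp [_root_.sum_apply, Finset.restrict]
  have hlaw : HasLaw (fun ω' => ∑ s : S, t s * Θ s.1 ω')
      (gaussianReal 0 Var[g ∘ X 0; P].toNNReal) P' := by
    refine ⟨hgauss.aemeasurable, ?_⟩
    rw [hgauss.map_eq_gaussianReal, hvar,
      integral_finsetSum _ fun s _ => ((hΘL s.1).integrable (by norm_num)).const_mul _]
    simp [integral_const_mul, hmean]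
  -- The classical central limit theorem for the i.i.d. variables g(X k).
  have hclt := tendstoInDistribution_inv_sqrt_mul_sum_sub (X := fun k => g ∘ X k) hlaw
    (hgL.comp_measurePreserving (hX0 0)) (hG.indep.comp (fun _ => g) fun _ => hgm)
    fun k => (⟨(hX0 k).measurable.aemeasurable, (hX0 0).measurable.aemeasurable,
      (hX0 k).map_eq.trans (hX0 0).map_eq.symm⟩ : IdentDistrib (X k) (X 0) P P).comp hgm
  have hEg : P[g ∘ X 0] = ∑ s : S, t s * (s.1.1 * W.indDensity s.1.2) := by
    have h1 : ∫ ω, g (X 0 ω) ∂P = ∫ u, g u := (hX0 0).integral_comp_of_measurable hgm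
    refine h1.trans ?_
    rw [integral_finsetSum _ fun s _ =>
      ((W.memLp_indProjection s.1.2).integrable (by norm_num)).const_mul _]
    simp [integral_const_mul, Graphon.integral_indProjection]
  rw [hEg] at hclt
  -- Slutsky: the difference from the normalized sum is the combination of the remainders, which
  -- tends to zero in probability.
  refine tendstoInDistribution_of_tendstoInMeasure_sub _ _ hclt ?_ ?_
  · convert! hG.tendstoInMeasure_sum_remainder S t using 1
    funext n ω
    simp only [Pi.sub_apply, Function.comp_apply, g, Graphon.remainder, Fintype.card_fin]
    rw [Finset.sum_comm, Finset.mul_sum, ← Finset.sum_sub_distrib, Finset.mul_sum,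
      ← Finset.sum_sub_distrib]
    refine Finset.sum_congr rfl fun s _ => ?_
    rw [← Finset.mul_sum]
    ring
  · intro n
    exact Finset.aemeasurable_fun_sum _ fun s _ => (((hG.memLp_indDensity s.1.2 n).sub
      (memLp_const _)).const_mul _ |>.const_mul _).aestronglyMeasurable.aemeasurable

end IsWRandomGraphSequence
end Fluctuations

end

theorem corollary3p4 {Ω : Type*} [MeasurableSpace Ω] (P : Measure Ω) [IsProbabilityMeasure P]
    (W : Graphon) (X : ℕ → Ω → I) (G : (n : ℕ) → Ω → SimpleGraph (Fin n))
    (hG : IsWRandomGraphSequence W P X G) :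
    (∃ (Ω' : Type) (_ : MeasurableSpace Ω') (P' : Measure Ω') (_ : IsProbabilityMeasure P')
        (Θ : FinGraph → Ω' → ℝ),
      IsGaussianProcess Θ P' ∧
      (∀ F, ∫ ω', Θ F ω' ∂P' = 0) ∧
      (∀ F₁ F₂, cov[Θ F₁, Θ F₂; P'] = W.indCovariance F₁ F₂) ∧
      ∀ S : Finset FinGraph,
        TendstoInDistribution
          (fun (n : ℕ) (ω : Ω) (F : S) =>
            Real.sqrt n * (F.1.2.indDensity (G n ω) - W.indDensity F.1.2))
          atTop (fun (ω' : Ω') (F : S) => Θ F.1 ω') (fun _ => P) P') ∧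
    ∀ F₁ F₂ : FinGraph,
      W.indCovariance F₁ F₂ =
        ∑ F₁' ∈ F₁.2.supergraphs, ∑ F₂' ∈ F₂.2.supergraphs,
          F₁.2.moebiusSign F₁' * F₂.2.moebiusSign F₂' *
            ((∑ q : Fin F₁.1, ∑ q' : Fin F₂.1, W.homDensity (F₁'.glue F₂' q q'))
              - F₁.1 * F₂.1 * W.homDensity F₁' * W.homDensity F₂') := by
  refine ⟨?_, fun F₁ F₂ => ?_⟩
  · obtain ⟨P', hP', Θ, hΘ, hmean, hcov⟩ := exists_gaussianProcess_covariance (volume : Measure I)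
      fun F : FinGraph => W.memLp_indProjection F.2
    refine ⟨ℕ → ℝ, inferInstance, P', hP', Θ, hΘ, hmean, hcov, fun S => ?_⟩
    refine tendstoInDistribution_pi (fun n => ?_) (hΘ.hasGaussianLaw S).aemeasurable
      (hG.tendstoInDistribution_sum hΘ hmean hcov S)
    exact aemeasurable_pi_lambda _ fun F => (((hG.memLp_indDensity F.1.2 n).sub
      (memLp_const _)).const_mul _).aestronglyMeasurable.aemeasurable
  · simpa only [Graphon.indCovariance, Fintype.card_fin] using W.covariance_indProjection F₁.2 F₂.2
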